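/- **Setting.** Let $M,d\ge 1$. Each of $M$ players has the action space $[0,1]^d$; joint arms are the points of $[0,1]^{Md}$. Fix a norm $\|\cdot\|$ on $\mathbb R^{Md}$ and $L>0$. The reward of a joint arm $a$ has a law $\nu_a$ that is $1$-subgaussian around its mean $\mu_a\in[0,1]$ (for instance any law on $[0,1]$), and $|\mu_a-\mu_b|\le L\|a-b\|$ for all $a,b$. In each round all players choose their individual arms simultaneously and without communication, every player then sees the joint arm $a_t$ and receives his own reward $X^i_t(a_t)\sim\nu_{a_t}$, which the others do not see; rewards are independent over rounds and players. With $\mu^*=\sup_a\mu_a$ and $\Delta_a=\mu^*-\mu_a$, the regret of player $i$ is $R_T=T\mu^*-\sum_{t=1}^T\mathbb E[X^i_t(a_t)]$. **Algorithm mZoom-B with horizon $T\ge2$.** Let $n_a$ be the number of pulls of $a$ so far, $\widehat\mu^i_a$ player $i$'s empirical mean of $a$, $\epsilon_a=\sqrt{6\log T/n_a}$, and let the ball of an active arm $a$ be the closed ball around $a$ of radius $\epsilon_a/L$ (everything if $n_a=0$). Initially $(\frac12,\dots,\frac12)$ is active and is the only member of an ordered desired set, and the grid is $\{0,\frac12,1\}^{Md}$.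 Before each round in which no catch-up is in progress, if some point of $[0,1]^{Md}$ lies in no ball of an active (possibly eliminated) arm, the mesh of the grid is halved until a grid point is uncovered (not at all if there already is one); the lexicographically smallest uncovered grid point becomes active and is put last into the desired set, and all players pull it (catch-up) in consecutive rounds until it has been pulled as often as the least pulled other desired arm. This is repeated until everything is covered. Then the next arm $c$ of the desired set in round-robin order is considered (catch-up pulls do not move the round-robin position). Every player $i$ for whom some active arm $a$ satisfies $\widehat\mu^i_c+2\epsilon_c<\widehat\mu^i_a-\epsilon_a$ deviates: instead of his component of $c$ he pulls a signal arm, which has at least one non-dyadic coordinate and is prescribed in advance as an arbitrary function of the player, the round and $c$. The other players pull their components of $c$. If the joint arm played differs from $c$, all players eliminate $c$ from the desired set (its ball remains). Should the desired set ever be empty, all players pull signal arms. Every pull, including catch-up pulls and deviations, uses one of the $T$ rounds. **Dimension and multiplier.** For $r>0$ let $X_r=\{a\in[0,1]^{Md}: r\le\Delta_a<2r\}$ and let $N_\rho(S)$ be the least number of sets of diameter at most $\rho$ that cover $S$. A real $z\ge0$ is an admissible dimension with multiplier $c$ if $N_{r/(3L)}(X_r)\le c\,r^{-z}$ for all $r>0$.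 **Theorem.** There is a constant $C>0$ depending only on $M$ and $d$ such that, for every norm and every $L>0$: 1. the dimension $z=Md$ is admissible with a multiplier $c$ that depends only on $M,d,L$ and the norm; 2. for every instance as above, every choice of signal arms, every admissible dimension $z\ge 0$ with multiplier $c$, every $T\ge2$ and every player, the regret of mZoom-B satisfies $$R_T\le C\,T^{\frac{z+1}{z+2}}(c\log T)^{\frac1{z+2}}.$$ In particular, with $z=Md$, $R_T=O\bigl(T^{\frac{Md+1}{Md+2}}(c\log T)^{\frac1{Md+2}}\bigr)$. -/

import Mathlib

open MeasureTheory ProbabilityTheory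

noncomputable section

namespace MZoomB

/-- The arms of one player: the cube `[0,1]^d`. -/
abbrev Arm (d : ℕ) := Fin d → unitInterval

/-- The joint arms of `M` players: the cube `[0,1]^(Md)`. -/
abbrev Joint (M d : ℕ) := Fin M → Arm d

variable {M d : ℕ}

/-- The distance of two joint arms in a given norm on `ℝ^(Md)`. -/
def armDist (N : Seminorm ℝ (Fin M → Fin d → ℝ)) (a b : Joint M d) : ℝ :=
  N (fun i k => (a i k : ℝ) - (b i k : ℝ))

/-! ### The instance: mean rewards, gaps, covering numbers -/

/-- The true mean of a joint arm whose reward has the law `ν a`. -/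
def mean (ν : Joint M d → Measure ℝ) (a : Joint M d) : ℝ := ∫ x, x ∂(ν a)

/-- The gap (badness) `μ* - μ a`. -/
def gap (μ : Joint M d → ℝ) (a : Joint M d) : ℝ := (⨆ b, μ b) - μ a

/-- `S` can be covered by `n` sets of diameter at most `ρ`, that is, `N_ρ(S) ≤ n`. -/
def CoverableBy (N : Seminorm ℝ (Fin M → Fin d → ℝ)) (S : Set (Joint M d)) (ρ : ℝ)
    (n : ℕ) : Prop :=
  ∃ U : Fin n → Set (Joint M d),
    (∀ j, ∀ x ∈ U j, ∀ y ∈ U j, armDist N x y ≤ ρ) ∧ S ⊆ ⋃ j, U j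

/-- The covering numbers at scale `r / (3L)` of the sets `X_r = {a : r ≤ Δ_a < 2r}` are at most
`c / r ^ z` for every `r > 0`: dimension `z` with multiplier `c`. -/
def ZoomingBound (N : Seminorm ℝ (Fin M → Fin d → ℝ)) (L : ℝ) (μ : Joint M d → ℝ)
    (z c : ℝ) : Prop :=
  ∀ r : ℝ, 0 < r → ∃ n : ℕ, (n : ℝ) ≤ c / r ^ z ∧
    CoverableBy N {a | r ≤ gap μ a ∧ gap μ a < 2 * r} (r / (3 * L)) n

/-! ### The algorithm -/

/-- The joint arm `(1/2, …, 1/2)`. -/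
def center : Joint M d := fun _ _ => ⟨1 / 2, by norm_num, by norm_num⟩

/-- The grid point of `{0, 1/2^ℓ, …, 1}^(Md)` that has the number `n` in the order on joint arms:
its numerators are the `M * d` digits of `n` in base `2^ℓ + 1`, the first coordinate of the first
player being the most significant digit. -/
def gridArm (l n : ℕ) : Joint M d := fun i k =>
  ⟨((n / (2 ^ l + 1) ^ (M * d - 1 - (i.val * d + k.val)) % (2 ^ l + 1) : ℕ) : ℝ) / 2 ^ l, by
    constructor
    · positivity
    · rw [div_le_one (by positivity)]
      have h := Nat.mod_lt (n / (2 ^ l + 1) ^ (M * d - 1 - (i.val * d + k.val)))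
        (Nat.succ_pos (2 ^ l))
      exact_mod_cast Nat.lt_succ_iff.mp h⟩

/-- An individual arm that lies on none of the grids: some coordinate is not dyadic. -/
def OffGrid (x : Arm d) : Prop := ∃ k, ∀ l m : ℕ, (x k : ℝ) ≠ (m : ℝ) / 2 ^ l

/-- The confidence radius `√(6 log T / n)` of an arm that was pulled `n` times. -/
def eps (T n : ℕ) : ℝ := Real.sqrt (6 * Real.log T / n)

/-- What all players know, being a function of the joint actions only. The desired set, in its
order, is `served ++ waiting`: the arms already considered and those still to be considered in the
current pass. `active` also holds the eliminated arms; `pending` holds the remaining pulls that a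
new arm needs to catch up; `count` holds the numbers of pulls. -/
structure PublicState (M d : ℕ) where
  level : ℕ
  active : List (Joint M d)
  served : List (Joint M d)
  waiting : List (Joint M d)
  pending : List (Joint M d)
  count : Joint M d → ℕ

/-- Initially `(1/2, …, 1/2)` is active and desired, and nothing has been pulled. -/
def PublicState.init : PublicState M d where
  level := 1
  active := [center]
  served := []
  waiting := [center]
  pending := []
  count := fun _ => 0

/-- `x` lies in the closed ball of radius `ε_a / L` around some active arm `a`. The ball of an arm
that was never pulled is everything. An eliminated arm is not pulled again, so its ball stays. -/
def PublicState.Covered (N : Seminorm ℝ (Fin M → Fin d → ℝ)) (L : ℝ) (T : ℕ)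
    (p : PublicState M d) (x : Joint M d) : Prop :=
  ∃ a ∈ p.active, p.count a = 0 ∨ armDist N x a ≤ eps T (p.count a) / L

open Classical in
/-- Update of the queues after the joint action `a`: a catch-up pull is ticked off, or else the
arm `c` under consideration is kept if `a = c` and eliminated if `a ≠ c`. When every desired arm
has been considered, the next pass starts. -/
def PublicState.advance (p : PublicState M d) (a : Joint M d) : PublicState M d :=
  match p.pending with
  | _ :: rest => { p with pending := rest }
  | [] =>
    match p.waiting with
    | [] => p
    | c :: w =>
      let s := if a = c then p.served ++ [c] else p.served
      if w = [] then { p with served := [], waiting := s }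
      else { p with served := s, waiting := w }

open Classical in
/-- If no catch-up is under way and some arm is uncovered, double the grid until it has an
uncovered point, activate the smallest one, put it last in the desired set, and schedule as many
pulls of it as the other desired arms have had. -/
def PublicState.activate (N : Seminorm ℝ (Fin M → Fin d → ℝ)) (L : ℝ) (T : ℕ)
    (p : PublicState M d) : PublicState M d :=
  if p.pending = [] ∧ ∃ x, ¬ p.Covered N L T x then
    let l := sInf {l : ℕ | p.level ≤ l ∧ ∃ n : ℕ, ¬ p.Covered N L T (gridArm l n)}
    let b := gridArm l (sInf {n : ℕ | ¬ p.Covered N L T (gridArm l n)})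
    let k := sInf {n : ℕ | ∃ a ∈ p.served ++ p.waiting, n = p.count a}
    { p with
      level := l
      active := p.active ++ [b]
      waiting := p.waiting ++ [b]
      pending := List.replicate k b }
  else p

open Classical in
/-- The public state after one more round, in which the joint action was `a`. -/
def PublicState.step (N : Seminorm ℝ (Fin M → Fin d → ℝ)) (L : ℝ) (T : ℕ)
    (p : PublicState M d) (a : Joint M d) : PublicState M d :=
  (({ p with count := Function.update p.count a (p.count a + 1) } :
    PublicState M d).advance a).activate N L T

open Classical in
/-- The arm that player `i` pulls in round `t`, given the public state and, for each joint arm, the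
sum `S` of the rewards that this player has received from it. `dev i t c` is the arm by which
player `i` signals the elimination of `c`. If the desired set is empty, everybody signals. -/
def playerArm (T : ℕ) (dev : Fin M → ℕ → Joint M d → Arm d) (t : ℕ) (p : PublicState M d)
    (i : Fin M) (S : Joint M d → ℝ) : Arm d :=
  match p.pending with
  | b :: _ => b i
  | [] =>
    match p.waiting with
    | [] => dev i t center
    | c :: _ =>
      if ∃ a ∈ p.active, S c / p.count c + 2 * eps T (p.count c) <
          S a / p.count a - eps T (p.count a)
      then dev i t c
      else c i

open Classical in
/-- The public state and the players' private reward sums before round `t` (rounds are numbered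
from `0`), when `x t i a` is the reward that player `i` gets in round `t` if the joint action is
`a`; player `i` sees `x t i a` for the joint action that is actually played only. -/
def run (N : Seminorm ℝ (Fin M → Fin d → ℝ)) (L : ℝ) (T : ℕ)
    (dev : Fin M → ℕ → Joint M d → Arm d) (x : ℕ → Fin M → Joint M d → ℝ) :
    ℕ → PublicState M d × (Fin M → Joint M d → ℝ)
  | 0 => (PublicState.init, fun _ _ => 0)
  | t + 1 =>
    let s := run N L T dev x t
    let a : Joint M d := fun i => playerArm T dev t s.1 i (s.2 i)
    (s.1.step N L T a, fun i => Function.update (s.2 i) a (s.2 i a + x t i a))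

/-- The joint action of round `t`. -/
def action (N : Seminorm ℝ (Fin M → Fin d → ℝ)) (L : ℝ) (T : ℕ)
    (dev : Fin M → ℕ → Joint M d → Arm d) (x : ℕ → Fin M → Joint M d → ℝ) (t : ℕ) :
    Joint M d :=
  fun i => playerArm T dev t (run N L T dev x t).1 i ((run N L T dev x t).2 i)

/-- The regret of player `i` over `T` rounds: `T μ* - ∑ E[reward of player i in round t]`. -/
def regret {Ω : Type*} [MeasurableSpace Ω] (P : Measure Ω)
    (N : Seminorm ℝ (Fin M → Fin d → ℝ)) (L : ℝ) (T : ℕ)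
    (dev : Fin M → ℕ → Joint M d → Arm d) (ν : Joint M d → Measure ℝ)
    (X : ℕ → Fin M → Joint M d → Ω → ℝ) (i : Fin M) : ℝ :=
  T * (⨆ a, mean ν a) - ∑ t ∈ Finset.range T,
    ∫ ω, X t i (action N L T dev (fun s j a => X s j a ω) t) ω ∂P

end MZoomB

end

namespace MZoomB

variable {M d : ℕ}

/-! ### Norms, packing and covering -/

section Geometry

open Metric Module

/-! On the clean event every empirical mean of a pulled arm stays within its confidence radius
before the horizon, and the course of the algorithm is controlled round by round (`Invariant`,
`invariant_run`). An optimal arm lies in the ball of some active arm, whose gap is then at most its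
own radius. A deviation proves that the considered arm has a gap above its radius, so the arm
covering the optimum is never eliminated. It has therefore been pulled at least as often as the
considered arm `c`, and if nobody deviates, the gap of `c` is at most six of its radii. Signal arms
are off the grid, so a deviation cannot be mistaken for `c` and never changes the count of an active
arm.

Consequently an active arm with gap `g` and `n` pulls satisfies `g ^ 2 * n ≤ 600 log T`, that is,
its radius is at least `g / 10`. A ball shrinks only when its arm is pulled, so a point that becomes
uncovered has a gap of at most seven radii and obeys the same bound once it is activated and caught
up. Since a new arm lies outside all earlier balls, active arms are separated on the scale of their
gaps, and this separation does not decay. A round lost to a signal costs at most 1 and is charged to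
the pulls of the arm it eliminates. Hence the total gap is at most twice the sum of gap times pulls
over the active arms (`Invariant.le_sum`).

A volume argument bounds the number of separated arms in one covering set by `8 ^ (M * d)`, whatever
the norm; so `c / r ^ z` covering sets bound the number of active arms with gap in `[r, 2r)`
(`ZoomingBound.card_le`). Gaps below `δ` cost at most `δ T`, the dyadic scales above `δ` sum to a
multiple of `c log T / δ ^ (z + 1)`, and the choice of `δ` balances the two (`sum_gap_le_of_clean`).

The arms are chosen adaptively from an infinite set. The failure probability is therefore bounded by
indexing an arm by the round of its first pull and by running an exponential supermartingale from
that round (`setLIntegral_expWeight_le`, `measure_large_expWeight_le`). Failures have probability at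
most `2M / T`, and even then each round costs at most twice the claimed bound
(`ZoomingBound.gap_le`). -/

theorem card_le_of_separated {E : Type*} [NormedAddCommGroup E] [NormedSpace ℝ E]
    [FiniteDimensional ℝ E] (s : Finset E) (x₀ : E) {R δ : ℝ} (hR : 0 ≤ R) (hδ : 0 < δ)
    (hs : ∀ x ∈ s, ‖x - x₀‖ ≤ R) (h : ∀ x ∈ s, ∀ y ∈ s, x ≠ y → 2 * δ ≤ ‖x - y‖) :
    (s.card : ℝ) ≤ ((R + δ) / δ) ^ finrank ℝ E := by
  borelize E
  let μ : Measure E := Measure.addHaar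
  -- Volume comparison: the balls of radius `δ` around the points are disjoint and lie in one ball
  -- of radius `R + δ`.
  have D : Set.Pairwise (s : Set E) (Function.onFun Disjoint fun c => ball (c : E) δ) := by
    rintro c hc d hd hcd
    apply ball_disjoint_ball
    rw [dist_eq_norm]
    linarith [h c hc d hd hcd]
  have hsub : (⋃ c ∈ s, ball (c : E) δ) ⊆ ball x₀ (R + δ) := by
    refine Set.iUnion₂_subset fun x hx => ?_
    apply ball_subset_ball'
    rw [dist_eq_norm]
    linarith [hs x hx]
  have I : (s.card : ENNReal) * ENNReal.ofReal (δ ^ finrank ℝ E) * μ (ball 0 1) ≤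
      ENNReal.ofReal ((R + δ) ^ finrank ℝ E) * μ (ball 0 1) :=
    calc
      (s.card : ENNReal) * ENNReal.ofReal (δ ^ finrank ℝ E) * μ (ball 0 1)
          = μ (⋃ c ∈ s, ball (c : E) δ) := by
        rw [measure_biUnion_finset D fun c _ => measurableSet_ball]
        simp only [μ.addHaar_ball_of_pos _ hδ]
        simp only [Finset.sum_const, nsmul_eq_mul, mul_assoc]
      _ ≤ μ (ball x₀ (R + δ)) := measure_mono hsub
      _ = ENNReal.ofReal ((R + δ) ^ finrank ℝ E) * μ (ball 0 1) := by
        rw [μ.addHaar_ball_of_pos _ (by linarith)]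
  have J : (s.card : ENNReal) * ENNReal.ofReal (δ ^ finrank ℝ E) ≤
      ENNReal.ofReal ((R + δ) ^ finrank ℝ E) :=
    (ENNReal.mul_le_mul_iff_left (measure_ball_pos _ _ zero_lt_one).ne' measure_ball_lt_top.ne).1 I
  have K := ENNReal.toReal_le_of_le_ofReal (by positivity) J
  rw [div_pow, le_div_iff₀ (by positivity)]
  rwa [ENNReal.toReal_mul, ENNReal.toReal_natCast, ENNReal.toReal_ofReal (by positivity)] at K

/-- The seminorm itself is installed as the norm of `E`, so the bound involves no comparison
constant between norms. This is what makes the final constant independent of the norm. -/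
theorem card_le_of_separated_seminorm {E : Type*} [AddCommGroup E] [Module ℝ E]
    [FiniteDimensional ℝ E] (N : Seminorm ℝ E) (hN : ∀ v, N v = 0 → v = 0)
    (s : Finset E) {R δ : ℝ} (hR : 0 ≤ R) (hδ : 0 < δ)
    (hs : ∀ x ∈ s, ∀ y ∈ s, N (x - y) ≤ R)
    (h : ∀ x ∈ s, ∀ y ∈ s, x ≠ y → 2 * δ ≤ N (x - y)) :
    (s.card : ℝ) ≤ ((R + δ) / δ) ^ finrank ℝ E := by
  rcases s.eq_empty_or_nonempty with rfl | ⟨x₀, hx₀⟩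
  · simp only [Finset.card_empty, Nat.cast_zero]; positivity
  let _ : NormedAddCommGroup E := AddGroupNorm.toNormedAddCommGroup
    { N.toAddGroupSeminorm with eq_zero_of_map_eq_zero' := hN }
  let _ : NormedSpace ℝ E := ⟨fun a b => (map_smul_eq_mul N a b).le⟩
  exact card_le_of_separated s x₀ hR hδ (fun x hx => hs x hx x₀ hx₀) h

theorem exists_seminorm_map_le {E F : Type*} [NormedAddCommGroup F] [NormedSpace ℝ F]
    [FiniteDimensional ℝ F] [AddCommGroup E] [Module ℝ E] (e : F →ₗ[ℝ] E) (N : Seminorm ℝ E) :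
    ∃ B, 0 < B ∧ ∀ v, N (e v) ≤ B * ‖v‖ := by
  let _ : SeminormedAddCommGroup E := N.toAddGroupSeminorm.toSeminormedAddCommGroup
  let _ : NormedSpace ℝ E := ⟨fun a b => (map_smul_eq_mul N a b).le⟩
  let f : F →L[ℝ] E := ⟨e, e.continuous_of_finiteDimensional⟩
  refine ⟨‖f‖ + 1, by positivity, fun v => (f.le_opNorm v).trans ?_⟩
  gcongr
  linarith

theorem exists_seminorm_le_mul (N : Seminorm ℝ (Fin M → Fin d → ℝ)) :
    ∃ B, 0 < B ∧ ∀ (a b : Joint M d) (η : ℝ), 0 ≤ η →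
      (∀ i k, |(a i k : ℝ) - b i k| ≤ η) → armDist N a b ≤ B * η := by
  obtain ⟨B, hB, h⟩ := exists_seminorm_map_le LinearMap.id N
  refine ⟨B, hB, fun a b η hη hab => (h _).trans ?_⟩
  gcongr
  rw [pi_norm_le_iff_of_nonneg hη]
  intro i
  rw [pi_norm_le_iff_of_nonneg hη]
  exact hab i

theorem armDist_self (N : Seminorm ℝ (Fin M → Fin d → ℝ)) (a : Joint M d) :
    armDist N a a = 0 := by
  rw [armDist]
  convert map_zero N
  simp

theorem armDist_comm (N : Seminorm ℝ (Fin M → Fin d → ℝ)) (a b : Joint M d) :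
    armDist N a b = armDist N b a := by
  rw [armDist, armDist, ← map_neg_eq_map]
  congr 1
  ext i k
  simp

theorem armDist_triangle (N : Seminorm ℝ (Fin M → Fin d → ℝ)) (a b c : Joint M d) :
    armDist N a c ≤ armDist N a b + armDist N b c := by
  refine le_trans (le_of_eq ?_) (map_add_le_add N _ _)
  rw [armDist]
  congr 1
  ext i k
  simp

/-- The number of points of a set of small diameter that are well separated is bounded in terms of
the dimension only. -/
theorem card_joint_le_of_separated (N : Seminorm ℝ (Fin M → Fin d → ℝ))
    (hN : ∀ v, N v = 0 → v = 0) (s : Finset (Joint M d)) {ρ : ℝ} (hρ : 0 < ρ)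
    (hs : ∀ x ∈ s, ∀ y ∈ s, armDist N x y ≤ ρ)
    (h : ∀ x ∈ s, ∀ y ∈ s, x ≠ y → 3 / 10 * ρ ≤ armDist N x y) :
    (s.card : ℝ) ≤ 8 ^ (M * d) := by
  let e : Joint M d → Fin M → Fin d → ℝ := fun a i k => a i k
  have he : Function.Injective e := fun a b hab => by
    ext i k
    exact congrFun (congrFun hab i) k
  -- With `δ = 3/20 ρ` the ratio `(ρ + δ) / δ` is `23/3`, which is below 8.
  have key := card_le_of_separated_seminorm N hN (s.map ⟨e, he⟩) (R := ρ) (δ := 3 / 20 * ρ)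
    hρ.le (by positivity) (by
      simp only [Finset.mem_map, Function.Embedding.coeFn_mk, forall_exists_index, and_imp,
        forall_apply_eq_imp_iff₂]
      exact hs) (by
      simp only [Finset.mem_map, Function.Embedding.coeFn_mk, forall_exists_index, and_imp,
        forall_apply_eq_imp_iff₂]
      intro x hx y hy hxy
      refine le_trans (le_of_eq (by ring)) (h x hx y hy fun h => hxy (by rw [h])))
  rw [Finset.card_map] at key
  refine key.trans ?_
  have hfr : finrank ℝ (Fin M → Fin d → ℝ) = M * d := by simp [Module.finrank_pi_fintype]
  rw [hfr]
  gcongr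
  rw [div_le_iff₀ (by positivity)]
  linarith

/-- The cube can be covered by `(q + 1) ^ (M * d)` sets of small diameter. -/
theorem coverableBy_cube (N : Seminorm ℝ (Fin M → Fin d → ℝ)) {B : ℝ}
    (h : ∀ (a b : Joint M d) (η : ℝ), 0 ≤ η →
      (∀ i k, |(a i k : ℝ) - b i k| ≤ η) → armDist N a b ≤ B * η)
    (S : Set (Joint M d)) (q : ℕ) (hq : 0 < q) {ρ : ℝ} (hρ : B / q ≤ ρ) :
    CoverableBy N S ρ ((q + 1) ^ (M * d)) := by
  have hcard : Fintype.card (Fin M → Fin d → Fin (q + 1)) = (q + 1) ^ (M * d) := by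
    simp [← pow_mul, mul_comm]
  let e := Fintype.equivFinOfCardEq hcard
  have hq' : (0 : ℝ) < q := by exact_mod_cast hq
  refine ⟨fun j => {a | ∀ i k, ⌊(a i k : ℝ) * q⌋₊ = (e.symm j i k : ℕ)}, ?_, ?_⟩
  · intro j x hx y hy
    refine (h x y (1 / q) (by positivity) fun i k => ?_).trans (le_trans (by rw [mul_one_div]) hρ)
    have h1 := hx i k
    have h2 := hy i k
    have h3 := Nat.floor_le (mul_nonneg (x i k).2.1 hq'.le)
    have h4 := Nat.floor_le (mul_nonneg (y i k).2.1 hq'.le)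
    have h5 := Nat.lt_floor_add_one ((x i k : ℝ) * q)
    have h6 := Nat.lt_floor_add_one ((y i k : ℝ) * q)
    rw [h1] at h3 h5
    rw [h2] at h4 h6
    rw [abs_le, neg_le, le_div_iff₀ hq', le_div_iff₀ hq']
    constructor <;> nlinarith
  · intro a _
    have hlt : ∀ i k, ⌊(a i k : ℝ) * q⌋₊ < q + 1 := fun i k => by
      rw [Nat.lt_succ_iff]
      refine Nat.floor_le_of_le ?_
      exact mul_le_of_le_one_left hq'.le (a i k).2.2
    rw [Set.mem_iUnion]
    refine ⟨e fun i k => ⟨_, hlt i k⟩, fun i k => ?_⟩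
    simp

theorem gap_nonneg {μ : Joint M d → ℝ} (hμ : ∀ a, μ a ≤ 1) (a : Joint M d) : 0 ≤ gap μ a :=
  sub_nonneg.2 (le_ciSup ⟨1, by rintro _ ⟨b, rfl⟩; exact hμ b⟩ a)

theorem gap_le_one {μ : Joint M d → ℝ} (hμ : ∀ a, 0 ≤ μ a ∧ μ a ≤ 1) (a : Joint M d) :
    gap μ a ≤ 1 := by
  have : Nonempty (Joint M d) := ⟨a⟩
  have := ciSup_le fun b => (hμ b).2
  have := (hμ a).1
  rw [gap]
  linarith

/-- Gaps are at most 1, so scales `r > 1` are empty. For `r ≤ 1` the whole cube is cut into cells;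
as `1 ≤ 1 / r`, the rounding up and the extra cell per axis are absorbed by the summand 2. -/
theorem exists_zoomingBound (N : Seminorm ℝ (Fin M → Fin d → ℝ)) {L : ℝ} (hL : 0 < L) :
    ∃ c : ℝ, ∀ μ : Joint M d → ℝ, (∀ a, 0 ≤ μ a ∧ μ a ≤ 1) →
      ZoomingBound N L μ ((M * d : ℕ) : ℝ) c := by
  obtain ⟨B, hB, h⟩ := exists_seminorm_le_mul N
  refine ⟨(3 * L * B + 2) ^ (M * d), fun μ hμ r hr => ?_⟩
  rw [Real.rpow_natCast, ← div_pow]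
  rcases le_or_gt r 1 with hr1 | hr1
  · have hpos : 0 < 3 * L * B / r := by positivity
    have hq : 0 < ⌈3 * L * B / r⌉₊ := Nat.ceil_pos.2 hpos
    refine ⟨_, ?_, coverableBy_cube N h _ ⌈3 * L * B / r⌉₊ hq ?_⟩
    · push_cast
      gcongr
      rw [add_div]
      have h1 : 1 ≤ 1 / r := by rwa [le_div_iff₀ hr, one_mul]
      have h2 : 2 / r = 1 / r + 1 / r := by ring
      linarith [Nat.ceil_lt_add_one hpos.le]
    · have := Nat.le_ceil (3 * L * B / r)
      rw [div_le_iff₀ hr] at this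
      rw [div_le_div_iff₀ (by exact_mod_cast hq) (by positivity)]
      linarith
  · refine ⟨0, by simp only [Nat.cast_zero]; positivity, fun j => j.elim0, fun j => j.elim0, ?_⟩
    rintro a ⟨ha, -⟩
    exact absurd (gap_le_one hμ a) (by linarith)

/-! ### The dyadic grids -/

/-- All coordinates are dyadic. -/
def OnGrid (a : Joint M d) : Prop := ∀ i, ¬ OffGrid (a i)

theorem onGrid_gridArm (l n : ℕ) : OnGrid (gridArm l n : Joint M d) := by
  rintro i ⟨k, hk⟩
  exact hk l _ rfl

theorem onGrid_center : OnGrid (center : Joint M d) := by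
  rintro i ⟨k, hk⟩
  exact hk 1 1 (by simp [center])

theorem exists_gridArm_eq (l : ℕ) (f : Fin M → Fin d → Fin (2 ^ l + 1)) :
    ∃ n, ∀ i k, ((gridArm l n : Joint M d) i k : ℝ) = (f i k : ℕ) / 2 ^ l := by
  -- `finFunctionFinEquiv` puts the least significant digit first, whereas in `gridArm` the first
  -- coordinate is the most significant; hence the reversal.
  let g : Fin (M * d) → Fin (2 ^ l + 1) := fun j =>
    f (finProdFinEquiv.symm j.rev).1 (finProdFinEquiv.symm j.rev).2
  refine ⟨finFunctionFinEquiv g, fun i k => ?_⟩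
  have h := congrFun (finFunctionFinEquiv.symm_apply_apply g) (finProdFinEquiv (i, k)).rev
  have hg : g (finProdFinEquiv (i, k)).rev = f i k := by
    simp only [g]
    rw [Fin.rev_rev, Equiv.symm_apply_apply]
  rw [hg, Fin.ext_iff, finFunctionFinEquiv_symm_apply_val] at h
  rw [← h]
  have he : ((finProdFinEquiv (i, k)).rev : ℕ) = M * d - 1 - (i.val * d + k.val) := by
    rw [Fin.val_rev, finProdFinEquiv_apply_val]
    simp only
    rw [mul_comm d]
    omega
  rw [he]
  rfl

theorem exists_gridArm_near (N : Seminorm ℝ (Fin M → Fin d → ℝ)) (x : Joint M d) (l₀ : ℕ)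
    {η : ℝ} (hη : 0 < η) : ∃ l, l₀ ≤ l ∧ ∃ n, armDist N x (gridArm l n) ≤ η := by
  obtain ⟨B, hB, h⟩ := exists_seminorm_le_mul (M := M) (d := d) N
  obtain ⟨l₁, hl₁⟩ := exists_pow_lt_of_lt_one (div_pos hη hB) (by norm_num : (1 / 2 : ℝ) < 1)
  let l := max l₀ l₁
  have hl : (1 / 2 : ℝ) ^ l ≤ η / B :=
    (pow_le_pow_of_le_one (by norm_num) (by norm_num) (le_max_right _ _)).trans hl₁.le
  have h2 : (0 : ℝ) < 2 ^ l := by positivity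
  have hlt : ∀ i k, ⌊(x i k : ℝ) * 2 ^ l⌋₊ < 2 ^ l + 1 := fun i k => by
    rw [Nat.lt_succ_iff]
    refine Nat.floor_le_of_le ?_
    push_cast
    exact mul_le_of_le_one_left h2.le (x i k).2.2
  obtain ⟨n, hn⟩ := exists_gridArm_eq l fun i k => ⟨_, hlt i k⟩
  refine ⟨l, le_max_left _ _, n, (h x _ (η / B) (by positivity) fun i k => ?_).trans
    (by rw [mul_div_cancel₀ _ hB.ne'])⟩
  refine le_trans ?_ hl
  rw [hn]
  have h3 := Nat.floor_le (mul_nonneg (x i k).2.1 h2.le)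
  have h4 := Nat.lt_floor_add_one ((x i k : ℝ) * 2 ^ l)
  rw [one_div, inv_pow, ← one_div, abs_le, neg_le, le_div_iff₀ h2, le_div_iff₀ h2, neg_mul,
    sub_mul, div_mul_cancel₀ _ h2.ne']
  constructor <;> simp only <;> linarith

/-- Lipschitz mean rewards attain their maximum. -/
theorem exists_gap_eq_zero (N : Seminorm ℝ (Fin M → Fin d → ℝ)) {L : ℝ} (hL : 0 < L)
    {μ : Joint M d → ℝ} (hμ : ∀ a b, |μ a - μ b| ≤ L * armDist N a b) :
    ∃ a, gap μ a = 0 := by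
  obtain ⟨B, hB, h⟩ := exists_seminorm_le_mul (M := M) (d := d) N
  have hc : Continuous μ := by
    refine (LipschitzWith.of_dist_le_mul (K := ⟨L * B, by positivity⟩) fun a b => ?_).continuous
    rw [Real.dist_eq]
    refine (hμ a b).trans ?_
    change _ ≤ L * B * dist a b
    rw [mul_assoc]
    gcongr
    refine h a b _ dist_nonneg fun i k => ?_
    exact (dist_le_pi_dist (a i) (b i) k).trans (dist_le_pi_dist a b i)
  obtain ⟨a, -, ha⟩ := isCompact_univ.exists_isMaxOn ⟨center, Set.mem_univ _⟩ hc.continuousOn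
  refine ⟨a, ?_⟩
  have : (⨆ b, μ b) = μ a := by
    have : Nonempty (Joint M d) := ⟨a⟩
    refine le_antisymm (ciSup_le fun b => ha (Set.mem_univ b)) (le_ciSup ⟨μ a, ?_⟩ a)
    rintro _ ⟨b, rfl⟩
    exact ha (Set.mem_univ b)
  rw [gap, this, sub_self]

end Geometry

/-! ### Confidence radii -/

theorem eps_nonneg (T n : ℕ) : 0 ≤ eps T n := Real.sqrt_nonneg _

theorem log_nonneg_of_horizon (T : ℕ) : 0 ≤ Real.log T := Real.log_natCast_nonneg T

theorem half_le_log {T : ℕ} (hT : 2 ≤ T) : 1 / 2 ≤ Real.log T := by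
  have h : Real.log 2 ≤ Real.log T := Real.log_le_log (by norm_num) (by exact_mod_cast hT)
  linarith [Real.log_two_gt_d9]

theorem eps_sq (T n : ℕ) : eps T n ^ 2 = 6 * Real.log T / n :=
  Real.sq_sqrt (div_nonneg (mul_nonneg (by norm_num) (log_nonneg_of_horizon T)) n.cast_nonneg)

theorem eps_sq_mul {T n : ℕ} (hn : 1 ≤ n) : eps T n ^ 2 * n = 6 * Real.log T := by
  rw [eps_sq, div_mul_cancel₀]
  positivity

theorem eps_anti (T : ℕ) {n k : ℕ} (hn : 1 ≤ n) (h : n ≤ k) : eps T k ≤ eps T n := by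
  refine Real.sqrt_le_sqrt ?_
  have := log_nonneg_of_horizon T
  gcongr

/-- A gap that is at most seven confidence radii leaves room for one more pull. -/
theorem sq_mul_le_of_le_eps {T n : ℕ} (hn : 1 ≤ n) {g : ℝ} (hg : 0 ≤ g) (h : g ≤ 7 * eps T n) :
    g ^ 2 * (n + 1 : ℕ) ≤ 600 * Real.log T := by
  have h1 : g ^ 2 ≤ 49 * eps T n ^ 2 := by nlinarith [eps_nonneg T n]
  have h2 : ((n + 1 : ℕ) : ℝ) ≤ 2 * n := by
    push_cast
    have : (1 : ℝ) ≤ n := by exact_mod_cast hn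
    linarith
  calc g ^ 2 * (n + 1 : ℕ) ≤ (49 * eps T n ^ 2) * (2 * n) := by gcongr
    _ = 98 * (eps T n ^ 2 * n) := by ring
    _ ≤ 600 * Real.log T := by
      rw [eps_sq_mul hn]
      linarith [log_nonneg_of_horizon T]

theorem le_eps_of_sq_mul_le {T n : ℕ} (hn : 1 ≤ n) {g : ℝ}
    (h : g ^ 2 * n ≤ 600 * Real.log T) : g / 10 ≤ eps T n := by
  refine Real.le_sqrt_of_sq_le ?_
  have : (0 : ℝ) < n := by exact_mod_cast hn
  rw [le_div_iff₀ this]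
  linarith

theorem gap_le_gap_add {N : Seminorm ℝ (Fin M → Fin d → ℝ)} {L : ℝ} {μ : Joint M d → ℝ}
    (hμ : ∀ a b, |μ a - μ b| ≤ L * armDist N a b) (a b : Joint M d) :
    gap μ a ≤ gap μ b + L * armDist N a b := by
  have := (abs_le.1 (hμ a b)).1
  rw [gap, gap]
  linarith

/-! ### The invariant of the public state -/

open Classical in
/-- The number of pulls of `a` once the current catch-up is over. -/
noncomputable def PublicState.vcount (p : PublicState M d) (a : Joint M d) : ℕ :=
  p.count a + p.pending.count a

theorem PublicState.vcount_of_pending_eq_nil {p : PublicState M d} (h : p.pending = [])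
    (a : Joint M d) : p.vcount a = p.count a := by
  simp [vcount, h]

open Classical in
/-- The invariant of the public state after `t` rounds of total gap `G` in which all confidence
bounds were correct: the waiting arms have `m` pulls, the served ones `m + 1`, active arms have not
been pulled too often for their gaps, and neither would be an uncovered arm with `k` pulls. -/
structure Invariant (N : Seminorm ℝ (Fin M → Fin d → ℝ)) (L : ℝ) (T : ℕ) (μ : Joint M d → ℝ)
    (p : PublicState M d) (m k : ℕ) (G : ℝ) (t : ℕ) : Prop where
  one_le : 1 ≤ m
  onGrid : ∀ a ∈ p.active, OnGrid a
  count_eq_zero : ∀ a, OnGrid a → a ∉ p.active → p.count a = 0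
  served_sub : ∀ a ∈ p.served, a ∈ p.active
  waiting_sub : ∀ a ∈ p.waiting, a ∈ p.active
  pending_sub : ∀ a ∈ p.pending, a ∈ p.waiting
  nodup : (p.served ++ p.waiting).Nodup
  waiting_eq : ∀ a ∈ p.waiting, p.vcount a = m
  served_eq : ∀ a ∈ p.served, p.vcount a = m + 1
  eliminated : ∀ a ∈ p.active, a ∉ p.served → a ∉ p.waiting →
    1 ≤ p.count a ∧ eps T (p.count a) < gap μ a
  bound : ∀ a ∈ p.active, gap μ a ^ 2 * p.vcount a ≤ 600 * Real.log T
  uncovered : ∀ x, (∃ a ∈ p.active, armDist N x a ≤ eps T (p.vcount a) / L) ∨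
    gap μ x ^ 2 * k ≤ 600 * Real.log T
  separated : p.active.Pairwise fun a b => gap μ a / 10 < L * armDist N b a
  total : ∑ a ∈ p.active.toFinset, p.count a ≤ t
  cost : ∃ Q : Finset (Joint M d), (∀ a ∈ Q, a ∈ p.active ∧ a ∉ p.served ∧ a ∉ p.waiting) ∧
    G ≤ ∑ a ∈ p.active.toFinset, gap μ a * p.count a + ∑ a ∈ Q, gap μ a * p.count a

section

variable {N : Seminorm ℝ (Fin M → Fin d → ℝ)} {L : ℝ} {T : ℕ} {μ : Joint M d → ℝ}
  {p : PublicState M d} {m k : ℕ} {G : ℝ} {t : ℕ}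

theorem Invariant.one_le_vcount (h : Invariant N L T μ p m k G t) {a : Joint M d}
    (ha : a ∈ p.active) : 1 ≤ p.vcount a := by
  have := h.one_le
  by_cases hs : a ∈ p.served
  · rw [h.served_eq a hs]; omega
  by_cases hw : a ∈ p.waiting
  · rwa [h.waiting_eq a hw]
  exact (h.eliminated a ha hs hw).1.trans (Nat.le_add_right _ _)

theorem PublicState.eps_lt_of_not_covered (hL : 0 < L) {x : Joint M d}
    (hx : ¬ p.Covered N L T x) {a : Joint M d} (ha : a ∈ p.active) :
    eps T (p.count a) < L * armDist N x a := by
  rw [PublicState.Covered] at hx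
  push Not at hx
  have := (hx a ha).2
  rwa [div_lt_iff₀' hL] at this

open Classical in
-- The infima in `activate` range over nonempty sets: an uncovered point keeps a positive distance
-- from the finitely many closed balls, and dyadic points of fine mesh come arbitrarily close to it.
-- Positive counts are needed because the ball of an unpulled arm is everything.
theorem PublicState.exists_activate_eq (hp : p.pending = [])
    (h : ∃ x, ¬ p.Covered N L T x) (hpos : ∀ a ∈ p.active, 1 ≤ p.count a) :
    ∃ (l : ℕ) (b : Joint M d), ¬ p.Covered N L T b ∧ OnGrid b ∧
      p.activate N L T = { p with
        level := l
        active := p.active ++ [b]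
        waiting := p.waiting ++ [b]
        pending := List.replicate
          (sInf {n : ℕ | ∃ a ∈ p.served ++ p.waiting, n = p.count a}) b } := by
  let S := {l : ℕ | p.level ≤ l ∧ ∃ n : ℕ, ¬ p.Covered N L T (gridArm l n)}
  have hS : S.Nonempty := by
    obtain ⟨x, hx⟩ := h
    have hx' : ∀ a ∈ p.active, ∃ η, 0 < η ∧ η < armDist N x a - eps T (p.count a) / L := by
      intro a ha
      rw [Covered] at hx
      push Not at hx
      exact exists_between (sub_pos.2 (hx a ha).2)
    obtain ⟨η, hη, hlt⟩ : ∃ η, 0 < η ∧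
        ∀ a ∈ p.active, η < armDist N x a - eps T (p.count a) / L := by
      generalize p.active = A at hx'
      induction A with
      | nil => exact ⟨1, one_pos, by simp⟩
      | cons a A ih =>
        obtain ⟨η₁, h₁, h₁'⟩ := ih fun a ha => hx' a (List.mem_cons_of_mem _ ha)
        obtain ⟨η₂, h₂, h₂'⟩ := hx' a List.mem_cons_self
        refine ⟨min η₁ η₂, lt_min h₁ h₂, fun b hb => ?_⟩
        rcases List.mem_cons.1 hb with rfl | hb
        · exact (min_le_right _ _).trans_lt h₂'
        · exact (min_le_left _ _).trans_lt (h₁' b hb)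
    obtain ⟨l, hl, n, hn⟩ := exists_gridArm_near N x p.level hη
    refine ⟨l, hl, n, ?_⟩
    rintro ⟨a, ha, h0 | hle⟩
    · have := hpos a ha
      omega
    · have h1 := hlt a ha
      have h2 := armDist_triangle N x (gridArm l n) a
      linarith
  have hn := (Nat.sInf_mem hS).2
  refine ⟨sInf S, gridArm (sInf S) (sInf {n : ℕ | ¬ p.Covered N L T (gridArm (sInf S) n)}),
    Nat.sInf_mem hn, onGrid_gridArm _ _, ?_⟩
  rw [activate, if_pos ⟨hp, h⟩]

/-- The catch-up is credited at once through `vcount`, so the new arm enters with `m` pulls. Being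
uncovered, it falls under the second alternative of `uncovered`, which is its bound; lying outside
the older balls, whose radii are at least a tenth of the gaps, it is separated from their centres.
-/
theorem Invariant.activate (h : Invariant N L T μ p m m G t) (hL : 0 < L)
    (hw : p.waiting ≠ []) :
    Invariant N L T μ (p.activate N L T) m m G t ∧ (p.activate N L T).waiting ≠ [] ∧
      ((p.activate N L T).pending = [] → ∀ x, (p.activate N L T).Covered N L T x) := by
  classical
  by_cases hc : p.pending = [] ∧ ∃ x, ¬ p.Covered N L T x
  swap
  · rw [PublicState.activate, if_neg hc]
    refine ⟨h, hw, fun hp x => ?_⟩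
    by_contra hx
    exact hc ⟨hp, x, hx⟩
  obtain ⟨hp, hx⟩ := hc
  have hv := PublicState.vcount_of_pending_eq_nil hp
  have hpos : ∀ a ∈ p.active, 1 ≤ p.count a := fun a ha => hv a ▸ h.one_le_vcount ha
  obtain ⟨l, b, hb, hbg, heq⟩ := PublicState.exists_activate_eq hp hx hpos
  -- The least pulled desired arms are the waiting ones, so the catch-up has length `m`.
  have hk : sInf {n : ℕ | ∃ a ∈ p.served ++ p.waiting, n = p.count a} = m := by
    obtain ⟨a, ha⟩ := List.exists_mem_of_ne_nil _ hw
    have ha' : p.count a = m := by rw [← hv, h.waiting_eq a ha]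
    refine le_antisymm (Nat.sInf_le ⟨a, List.mem_append_right _ ha, ha'.symm⟩) ?_
    refine le_csInf ⟨_, a, List.mem_append_right _ ha, rfl⟩ ?_
    rintro _ ⟨a, ha, rfl⟩
    rw [← hv]
    rcases List.mem_append.1 ha with ha | ha
    · rw [h.served_eq a ha]; omega
    · rw [h.waiting_eq a ha]
  have hba : b ∉ p.active := fun hba => hb
    ⟨b, hba, Or.inr (by rw [armDist_self]; exact div_nonneg (eps_nonneg _ _) hL.le)⟩
  have hb0 : p.count b = 0 := h.count_eq_zero b hbg hba
  rw [hk] at heq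
  rw [heq]
  clear heq hk
  set q : PublicState M d := { p with
    level := l, active := p.active ++ [b], waiting := p.waiting ++ [b]
    pending := List.replicate m b } with hq
  have hne : ∀ a ∈ p.active, a ≠ b := fun a ha hab => hba (hab ▸ ha)
  have hqv : ∀ a ∈ p.active, q.vcount a = p.vcount a := fun a ha => by
    rw [hv, PublicState.vcount, List.count_eq_zero_of_not_mem]
    · rfl
    · exact fun hmem => hne a ha (List.eq_of_mem_replicate hmem)
  have hqb : q.vcount b = m := by
    rw [PublicState.vcount, List.count_replicate_self]
    exact hb0.symm ▸ zero_add m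
  have hbm : gap μ b ^ 2 * m ≤ 600 * Real.log T := by
    rcases h.uncovered b with ⟨a, ha, hle⟩ | hle
    · exact absurd ⟨a, ha, Or.inr (hv a ▸ hle)⟩ hb
    · exact hle
  have hmem : ∀ a, a ∈ q.active ↔ a ∈ p.active ∨ a = b := fun a => by simp [hq]
  have hmemw : ∀ a, a ∈ q.waiting ↔ a ∈ p.waiting ∨ a = b := fun a => by simp [hq]
  have hsum : ∀ f : Joint M d → ℕ → ℝ, f b 0 = 0 → ∑ a ∈ q.active.toFinset, f a (q.count a) =
      ∑ a ∈ p.active.toFinset, f a (p.count a) := fun f hf => by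
    have : q.active.toFinset = insert b p.active.toFinset := by
      ext a; simp [hq]
    rw [this, Finset.sum_insert (by simpa using hba)]
    change f b (p.count b) + _ = _
    rw [hb0, hf, zero_add]
  refine ⟨?_, by simp [hq], fun hpe => ?_⟩
  · refine
    { one_le := h.one_le
      onGrid := ?_
      count_eq_zero := fun a ha hn => h.count_eq_zero a ha fun h' => hn ((hmem a).2 (Or.inl h'))
      served_sub := fun a ha => (hmem a).2 (Or.inl (h.served_sub a ha))
      waiting_sub := ?_
      pending_sub := fun a ha => (hmemw a).2 (Or.inr (List.eq_of_mem_replicate ha))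
      nodup := ?_
      waiting_eq := ?_
      served_eq := fun a ha => (hqv a (h.served_sub a ha)).trans (h.served_eq a ha)
      eliminated := ?_
      bound := ?_
      uncovered := ?_
      separated := ?_
      total := ?_
      cost := ?_ }
    · intro a ha
      rcases (hmem a).1 ha with ha | rfl
      · exact h.onGrid a ha
      · exact hbg
    · intro a ha
      exact (hmem a).2 (((hmemw a).1 ha).imp_left (h.waiting_sub a))
    · change (p.served ++ (p.waiting ++ [b])).Nodup
      rw [← List.append_assoc, List.nodup_append]
      refine ⟨h.nodup, by simp, fun a ha c hc hac => ?_⟩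
      rw [List.mem_singleton.1 hc] at hac
      refine hne a ?_ hac
      exact (List.mem_append.1 ha).elim (h.served_sub a) (h.waiting_sub a)
    · intro a ha
      rcases (hmemw a).1 ha with ha | rfl
      · exact (hqv a (h.waiting_sub a ha)).trans (h.waiting_eq a ha)
      · exact hqb
    · intro a ha hs hw'
      rcases (hmem a).1 ha with ha | rfl
      · exact h.eliminated a ha hs fun h' => hw' ((hmemw a).2 (Or.inl h'))
      · exact absurd ((hmemw a).2 (Or.inr rfl)) hw'
    · intro a ha
      rcases (hmem a).1 ha with ha | rfl
      · rw [hqv a ha]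
        exact h.bound a ha
      · rwa [hqb]
    · intro x
      refine (h.uncovered x).imp_left ?_
      rintro ⟨a, ha, hle⟩
      exact ⟨a, (hmem a).2 (Or.inl ha), by rwa [hqv a ha]⟩
    · change (p.active ++ [b]).Pairwise _
      rw [List.pairwise_append]
      refine ⟨h.separated, List.pairwise_singleton _ _, fun a ha c hc => ?_⟩
      rw [List.mem_singleton.1 hc]
      have hb := h.bound a ha
      rw [hv] at hb
      exact (le_eps_of_sq_mul_le (hpos a ha) hb).trans_lt (PublicState.eps_lt_of_not_covered hL ‹_› ha)
    · have := hsum (fun _ n => n) (by simp)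
      have h' := h.total
      rw [← Nat.cast_le (α := ℝ), Nat.cast_sum] at h' ⊢
      rwa [this]
    · obtain ⟨Q, hQ, hG⟩ := h.cost
      refine ⟨Q, fun a ha => ⟨(hmem a).2 (Or.inl (hQ a ha).1), (hQ a ha).2.1, fun h' => ?_⟩, ?_⟩
      · exact ((hmemw a).1 h').elim (hQ a ha).2.2 (hne a (hQ a ha).1)
      · rw [hsum (fun a n => gap μ a * n) (by simp)]
        exact hG
  -- Since `m ≥ 1`, a catch-up is under way right after an activation, so the covering claim is
  -- vacuous here.
  · have : m = 0 := by simpa [hq] using hpe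
    have := h.one_le
    omega

/-! ### Preservation of the invariant by one round -/

open Classical in
/-- The public state with the pull of `a` counted. -/
noncomputable def PublicState.pull (p : PublicState M d) (a : Joint M d) : PublicState M d :=
  { p with count := Function.update p.count a (p.count a + 1) }

theorem PublicState.pull_count_self (a : Joint M d) : (p.pull a).count a = p.count a + 1 :=
  Function.update_self ..

theorem PublicState.pull_count_of_ne {a b : Joint M d} (h : b ≠ a) :
    (p.pull a).count b = p.count b :=
  Function.update_of_ne h ..

open Classical in
theorem PublicState.sum_pull_count (F : Finset (Joint M d)) (f : Joint M d → ℝ) (b : Joint M d) :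
    ∑ a ∈ F, f a * (p.pull b).count a =
      ∑ a ∈ F, f a * p.count a + if b ∈ F then f b else 0 := by
  have : ∀ a, f a * ((p.pull b).count a : ℝ) = f a * p.count a + if b = a then f a else 0 := by
    intro a
    by_cases h : a = b
    · rw [h, pull_count_self, if_pos rfl]
      push_cast
      ring
    · rw [pull_count_of_ne h, if_neg (Ne.symm h), add_zero]
  rw [Finset.sum_congr rfl fun a _ => this a, Finset.sum_add_distrib, Finset.sum_ite_eq]

open Classical in
/-- The total number of pulls of a set of arms grows by at most one. -/
theorem PublicState.sum_pull_count_le (F : Finset (Joint M d)) (b : Joint M d) {n : ℕ}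
    (h : ∑ a ∈ F, p.count a ≤ n) : ∑ a ∈ F, (p.pull b).count a ≤ n + 1 := by
  have := PublicState.sum_pull_count (p := p) F (fun _ => 1) b
  simp only [one_mul] at this
  rw [← Nat.cast_le (α := ℝ), Nat.cast_sum] at h ⊢
  rw [this]
  push_cast
  gcongr
  split_ifs <;> norm_num

/-- The next pass starts when no arm is waiting. -/
theorem Invariant.rotate (h : Invariant N L T μ p m (m + 1) G t) (hp : p.pending = [])
    (hne : p.served ≠ [] ∨ p.waiting ≠ []) {q : PublicState M d}
    (hq : p.waiting = [] → q = { p with served := [], waiting := p.served })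
    (hq' : p.waiting ≠ [] → q = p) :
    ∃ m', Invariant N L T μ q m' m' G t ∧ q.waiting ≠ [] := by
  by_cases hw : p.waiting = []
  · rw [hq hw]
    refine ⟨m + 1, ?_, by simpa [hw] using hne⟩
    refine
    { one_le := by omega
      onGrid := h.onGrid
      count_eq_zero := h.count_eq_zero
      served_sub := by simp
      waiting_sub := h.served_sub
      pending_sub := by simp [hp]
      nodup := by simpa [hw] using h.nodup
      waiting_eq := h.served_eq
      served_eq := by simp
      eliminated := fun a ha _ hs => h.eliminated a ha hs (by simp [hw])
      bound := h.bound
      uncovered := h.uncovered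
      separated := h.separated
      total := h.total
      cost := ?_ }
    obtain ⟨Q, hQ, hG⟩ := h.cost
    exact ⟨Q, fun a ha => ⟨(hQ a ha).1, by simp, (hQ a ha).2.1⟩, hG⟩
  · rw [hq' hw]
    refine ⟨m, { h with uncovered := fun x => (h.uncovered x).imp_right fun hx => ?_ }, hw⟩
    refine le_trans ?_ hx
    gcongr
    omega

/-- A catch-up pull moves one unit from `pending` to `count`, so `vcount` and all conditions stated
through it are unchanged. The pulled arm is waiting, hence active and outside `Q`, and its own count
pays for the round. -/
theorem Invariant.catchUp (h : Invariant N L T μ p m m G t) (hw : p.waiting ≠ [])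
    {b : Joint M d} {rest : List (Joint M d)} (hp : p.pending = b :: rest) :
    ∃ m', Invariant N L T μ ((p.pull b).advance b) m' m' (G + gap μ b) (t + 1) ∧
      ((p.pull b).advance b).waiting ≠ [] := by
  classical
  have heq : (p.pull b).advance b = { p.pull b with pending := rest } := by
    rw [PublicState.advance]
    simp [PublicState.pull, hp]
  rw [heq]
  set q : PublicState M d := { p.pull b with pending := rest } with hq
  have hv : ∀ a, q.vcount a = p.vcount a := by
    intro a
    change (p.pull b).count a + rest.count a = p.count a + p.pending.count a
    rw [hp]
    by_cases ha : a = b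
    · subst ha
      rw [PublicState.pull_count_self, List.count_cons_self]
      omega
    · rw [PublicState.pull_count_of_ne ha, List.count_cons_of_ne (Ne.symm ha)]
  have hbw : b ∈ p.waiting := h.pending_sub b (by simp [hp])
  have hba : b ∈ p.active := h.waiting_sub b hbw
  refine ⟨m, ?_, hw⟩
  refine
  { one_le := h.one_le
    onGrid := h.onGrid
    count_eq_zero := ?_
    served_sub := h.served_sub
    waiting_sub := h.waiting_sub
    pending_sub := fun a ha => h.pending_sub a (by rw [hp]; exact List.mem_cons_of_mem _ ha)
    nodup := h.nodup
    waiting_eq := fun a ha => (hv a).trans (h.waiting_eq a ha)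
    served_eq := fun a ha => (hv a).trans (h.served_eq a ha)
    eliminated := ?_
    bound := fun a ha => by rw [hv]; exact h.bound a ha
    uncovered := fun x => by simp only [hv]; exact h.uncovered x
    separated := h.separated
    total := PublicState.sum_pull_count_le _ _ h.total
    cost := ?_ }
  · intro a ha hn
    exact (PublicState.pull_count_of_ne fun hab : a = b => hn (hab ▸ hba)).trans (h.count_eq_zero a ha hn)
  · intro a ha hs hw'
    have := h.eliminated a ha hs hw'
    rwa [← PublicState.pull_count_of_ne (p := p) (a := b) fun hab : a = b => hw' (hab ▸ hbw)] at this
  · obtain ⟨Q, hQ, hG⟩ := h.cost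
    refine ⟨Q, hQ, ?_⟩
    change _ ≤ ∑ a ∈ p.active.toFinset, gap μ a * (p.pull b).count a +
      ∑ a ∈ Q, gap μ a * (p.pull b).count a
    rw [PublicState.sum_pull_count, PublicState.sum_pull_count,
      if_pos (by simpa using hba), if_neg fun hb => (hQ b hb).2.2 hbw]
    linarith

/-- Only the ball of `c` shrinks. A point that loses its cover lies within `eps T m / L` of `c`, so
its gap is at most `6 + 1` radii, which still permits `m + 1` pulls. This is why the intermediate
invariant has `k = m + 1`: the pass may end here and raise `m`. -/
theorem Invariant.keep (h : Invariant N L T μ p m m G t) (hL : 0 < L)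
    (hμ1 : ∀ a, μ a ≤ 1) (hμ : ∀ a b, |μ a - μ b| ≤ L * armDist N a b)
    (hp : p.pending = []) {c : Joint M d} {w : List (Joint M d)} (hw : p.waiting = c :: w)
    (hcov : ∀ x, p.Covered N L T x) (hc : gap μ c ≤ 6 * eps T m) :
    ∃ m', Invariant N L T μ ((p.pull c).advance c) m' m' (G + gap μ c) (t + 1) ∧
      ((p.pull c).advance c).waiting ≠ [] := by
  classical
  set q : PublicState M d := { p.pull c with served := p.served ++ [c], waiting := w } with hq
  have hqp : q.pending = [] := hp
  have hv := PublicState.vcount_of_pending_eq_nil hp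
  have hqv := PublicState.vcount_of_pending_eq_nil hqp
  have hvne : ∀ a, a ≠ c → q.vcount a = p.vcount a := fun a ha => by
    rw [hv, hqv]
    exact PublicState.pull_count_of_ne ha
  have hcw : c ∈ p.waiting := by simp [hw]
  have hca : c ∈ p.active := h.waiting_sub c hcw
  have hvc : q.vcount c = m + 1 := by
    rw [hqv, ← h.waiting_eq c hcw, hv]
    exact PublicState.pull_count_self c
  have hnd := h.nodup
  rw [hw, List.nodup_append] at hnd
  obtain ⟨hns, hncw, hdis⟩ := hnd
  rw [List.nodup_cons] at hncw
  have hg := gap_nonneg hμ1 c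
  have hcm := sq_mul_le_of_le_eps h.one_le hg (by linarith [eps_nonneg T m])
  have hinv : Invariant N L T μ q m (m + 1) (G + gap μ c) (t + 1) := by
    refine
    { one_le := h.one_le
      onGrid := h.onGrid
      count_eq_zero := ?_
      served_sub := ?_
      waiting_sub := fun a ha => h.waiting_sub a (by rw [hw]; exact List.mem_cons_of_mem _ ha)
      pending_sub := by simp [hqp]
      nodup := ?_
      waiting_eq := ?_
      served_eq := ?_
      eliminated := ?_
      bound := ?_
      uncovered := ?_
      separated := h.separated
      total := PublicState.sum_pull_count_le _ _ h.total
      cost := ?_ }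
    · intro a ha hn
      exact (PublicState.pull_count_of_ne fun hab : a = c => hn (hab ▸ hca)).trans
        (h.count_eq_zero a ha hn)
    · intro a ha
      rcases List.mem_append.1 ha with ha | ha
      · exact h.served_sub a ha
      · rwa [List.mem_singleton.1 ha]
    · change ((p.served ++ [c]) ++ w).Nodup
      rw [List.append_assoc, List.singleton_append, ← hw]
      exact h.nodup
    · intro a ha
      rw [hvne a fun hac => hncw.1 (hac ▸ ha)]
      exact h.waiting_eq a (by rw [hw]; exact List.mem_cons_of_mem _ ha)
    · intro a ha
      rcases List.mem_append.1 ha with ha | ha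
      · rw [hvne a fun hac => hdis a ha c List.mem_cons_self hac]
        exact h.served_eq a ha
      · rw [List.mem_singleton.1 ha, hvc]
    · intro a ha hs hw'
      have hac : a ≠ c := fun hac => hs (by simp [hq, hac])
      have := h.eliminated a ha (fun h' => hs (List.mem_append_left _ h')) (by
        rw [hw, List.mem_cons]
        exact not_or.2 ⟨hac, hw'⟩)
      rwa [← PublicState.pull_count_of_ne (p := p) hac] at this
    · intro a ha
      by_cases hac : a = c
      · rw [hac, hvc]
        exact hcm
      · rw [hvne a hac]
        exact h.bound a ha
    · intro x
      obtain ⟨a, ha, hx⟩ := hcov x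
      have hpos := hv a ▸ h.one_le_vcount ha
      have hx : armDist N x a ≤ eps T (p.count a) / L := hx.resolve_left (by omega)
      by_cases hac : a = c
      · right
        refine sq_mul_le_of_le_eps h.one_le (gap_nonneg hμ1 x) ?_
        rw [hac, ← hv, h.waiting_eq c hcw, le_div_iff₀' hL] at hx
        linarith [gap_le_gap_add hμ x c]
      · left
        exact ⟨a, ha, by rwa [hvne a hac, hv]⟩
    · obtain ⟨Q, hQ, hG⟩ := h.cost
      have hcQ : c ∉ Q := fun hc => (hQ c hc).2.2 hcw
      refine ⟨Q, fun a ha => ⟨(hQ a ha).1, fun hs => ?_, fun hw' => ?_⟩, ?_⟩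
      · rcases List.mem_append.1 hs with hs | hs
        · exact (hQ a ha).2.1 hs
        · exact hcQ (List.mem_singleton.1 hs ▸ ha)
      · exact (hQ a ha).2.2 (by rw [hw]; exact List.mem_cons_of_mem _ hw')
      · change _ ≤ ∑ a ∈ p.active.toFinset, gap μ a * (p.pull c).count a +
          ∑ a ∈ Q, gap μ a * (p.pull c).count a
        rw [PublicState.sum_pull_count, PublicState.sum_pull_count,
          if_pos (by simpa using hca), if_neg hcQ]
        linarith
  refine hinv.rotate hqp (Or.inl (by simp [hq])) (fun hwn => ?_) fun hwn => ?_
  · rw [PublicState.advance]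
    have hwn : w = [] := hwn
    simp [PublicState.pull, hp, hw, hwn, hq]
  · rw [PublicState.advance]
    have hwn : w ≠ [] := hwn
    simp [PublicState.pull, hp, hw, hwn, hq]

/-- The signal arm `A` is off the grid, so no active arm gains a pull and no ball shrinks. The round
is charged to `c`, which joins `Q`; it was desired before, so it is charged only once. -/
theorem Invariant.drop (h : Invariant N L T μ p m m G t) (hL : 0 < L) (hT : 2 ≤ T)
    (hμ1 : ∀ a, 0 ≤ μ a ∧ μ a ≤ 1) (hμ : ∀ a b, |μ a - μ b| ≤ L * armDist N a b)
    (hp : p.pending = []) {c : Joint M d} {w : List (Joint M d)} (hw : p.waiting = c :: w)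
    (hcov : ∀ x, p.Covered N L T x) (hc : eps T m < gap μ c) {A : Joint M d}
    (hA : ¬ OnGrid A) :
    ∃ m', Invariant N L T μ ((p.pull A).advance A) m' m' (G + gap μ A) (t + 1) ∧
      ((p.pull A).advance A).waiting ≠ [] := by
  classical
  set q : PublicState M d := { p.pull A with served := p.served, waiting := w } with hq
  have hqp : q.pending = [] := hp
  have hv := PublicState.vcount_of_pending_eq_nil hp
  have hqv := PublicState.vcount_of_pending_eq_nil hqp
  have hAne : ∀ a ∈ p.active, a ≠ A := fun a ha haA => hA (haA ▸ h.onGrid a ha)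
  have hcnt : ∀ a ∈ p.active, (p.pull A).count a = p.count a := fun a ha =>
    PublicState.pull_count_of_ne (hAne a ha)
  have hvne : ∀ a ∈ p.active, q.vcount a = p.vcount a := fun a ha => by
    rw [hv, hqv]
    exact hcnt a ha
  have hcw : c ∈ p.waiting := by simp [hw]
  have hca : c ∈ p.active := h.waiting_sub c hcw
  have hcm : p.count c = m := by rw [← hv, h.waiting_eq c hcw]
  have hnd := h.nodup
  rw [hw, List.nodup_append] at hnd
  obtain ⟨hns, hncw, hdis⟩ := hnd
  rw [List.nodup_cons] at hncw
  have hwsub : ∀ a ∈ w, a ∈ p.waiting := fun a ha => by rw [hw]; exact List.mem_cons_of_mem _ ha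
  have hcov' : ∀ x, ∃ a ∈ p.active, 1 ≤ p.count a ∧ armDist N x a ≤ eps T (p.count a) / L := by
    intro x
    obtain ⟨a, ha, hx⟩ := hcov x
    have hpos := hv a ▸ h.one_le_vcount ha
    exact ⟨a, ha, hpos, hx.resolve_left (by omega)⟩
  have hel : ∀ a ∈ q.active, a ∉ q.served → a ∉ q.waiting →
      1 ≤ q.count a ∧ eps T (q.count a) < gap μ a := by
    intro a ha hs hw'
    change 1 ≤ (p.pull A).count a ∧ eps T ((p.pull A).count a) < gap μ a
    rw [hcnt a ha]
    by_cases hac : a = c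
    · rw [hac, hcm]
      exact ⟨h.one_le, hc⟩
    · refine h.eliminated a ha hs ?_
      rw [hw, List.mem_cons]
      exact not_or.2 ⟨hac, hw'⟩
  -- As the radius is below the gap and the gap is at most 1, `gap μ c * m ≥ eps T m ^ 2 * m = 6 log
  -- T ≥ 3`.
  have hcost : 1 ≤ gap μ c * m := by
    have h0 := (gap_nonneg (fun a => (hμ1 a).2) c)
    have h1 := gap_le_one hμ1 c
    have h2 := eps_sq_mul (T := T) h.one_le
    have h3 := half_le_log hT
    have h4 : eps T m ^ 2 ≤ gap μ c := by nlinarith [eps_nonneg T m]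
    nlinarith
  have hinv : Invariant N L T μ q m (m + 1) (G + gap μ A) (t + 1) := by
    refine
    { one_le := h.one_le
      onGrid := h.onGrid
      count_eq_zero := ?_
      served_sub := h.served_sub
      waiting_sub := fun a ha => h.waiting_sub a (hwsub a ha)
      pending_sub := by simp [hqp]
      nodup := ?_
      waiting_eq := fun a ha => (hvne a (h.waiting_sub a (hwsub a ha))).trans
        (h.waiting_eq a (hwsub a ha))
      served_eq := fun a ha => (hvne a (h.served_sub a ha)).trans (h.served_eq a ha)
      eliminated := hel
      bound := fun a ha => by rw [hvne a ha]; exact h.bound a ha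
      uncovered := ?_
      separated := h.separated
      total := PublicState.sum_pull_count_le _ _ h.total
      cost := ?_ }
    · intro a ha hn
      exact (PublicState.pull_count_of_ne fun haA : a = A => hA (haA ▸ ha)).trans
        (h.count_eq_zero a ha hn)
    · change (p.served ++ w).Nodup
      rw [List.nodup_append]
      exact ⟨hns, hncw.2, fun a ha b hb => hdis a ha b (List.mem_cons_of_mem _ hb)⟩
    · intro x
      obtain ⟨a, ha, hpos, hx⟩ := hcov' x
      exact Or.inl ⟨a, ha, by rwa [hvne a ha, hv]⟩
    · obtain ⟨Q, hQ, hG⟩ := h.cost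
      have hcQ : c ∉ Q := fun hc => (hQ c hc).2.2 hcw
      refine ⟨insert c Q, fun a ha => ?_, ?_⟩
      · rcases Finset.mem_insert.1 ha with rfl | ha
        · exact ⟨hca, fun hs => hdis a hs a List.mem_cons_self rfl, hncw.1⟩
        · exact ⟨(hQ a ha).1, (hQ a ha).2.1, fun hw' => (hQ a ha).2.2 (hwsub a hw')⟩
      · change _ ≤ ∑ a ∈ p.active.toFinset, gap μ a * (p.pull A).count a +
          ∑ a ∈ insert c Q, gap μ a * (p.pull A).count a
        rw [Finset.sum_insert hcQ, hcnt c hca, hcm, PublicState.sum_pull_count,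
          PublicState.sum_pull_count, if_neg, if_neg]
        · linarith [gap_le_one hμ1 A]
        · exact fun hAQ => hAne A (hQ A hAQ).1 rfl
        · exact fun hAF => hAne A (List.mem_toFinset.1 hAF) rfl
  -- The arm whose ball contains an optimal arm has a gap within its radius, so it cannot be
  -- eliminated and the desired set is never empty.
  have hne : q.served ≠ [] ∨ q.waiting ≠ [] := by
    obtain ⟨x, hx⟩ := exists_gap_eq_zero N hL hμ
    obtain ⟨a, ha, hpos, hxa⟩ := hcov' x
    by_contra hcon
    push Not at hcon
    have h1 := (hel a ha (by simp [hcon.1]) (by simp [hcon.2])).2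
    change eps T ((p.pull A).count a) < gap μ a at h1
    rw [hcnt a ha] at h1
    rw [armDist_comm, le_div_iff₀' hL] at hxa
    linarith [gap_le_gap_add hμ a x]
  have hAc : A ≠ c := fun hAc => hAne c hca hAc.symm
  refine hinv.rotate hqp hne (fun hwn => ?_) fun hwn => ?_
  · rw [PublicState.advance]
    have hwn : w = [] := hwn
    simp [PublicState.pull, hp, hw, hwn, hq, hAc]
  · rw [PublicState.advance]
    have hwn : w ≠ [] := hwn
    simp [PublicState.pull, hp, hw, hwn, hq, hAc]

end

/-! ### The invariant along a run -/

section

variable {N : Seminorm ℝ (Fin M → Fin d → ℝ)} {L : ℝ} {T : ℕ} {μ : Joint M d → ℝ}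
  {dev : Fin M → ℕ → Joint M d → Arm d} {x : ℕ → Fin M → Joint M d → ℝ}

/-- All confidence bounds are correct in the first `T` rounds. -/
def Clean (N : Seminorm ℝ (Fin M → Fin d → ℝ)) (L : ℝ) (T : ℕ)
    (dev : Fin M → ℕ → Joint M d → Arm d) (μ : Joint M d → ℝ)
    (x : ℕ → Fin M → Joint M d → ℝ) : Prop :=
  ∀ t < T, ∀ j a, 1 ≤ (run N L T dev x t).1.count a →
    |(run N L T dev x t).2 j a / (run N L T dev x t).1.count a - μ a| ≤
      eps T ((run N L T dev x t).1.count a)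

theorem run_succ_fst (t : ℕ) : (run N L T dev x (t + 1)).1 =
    (((run N L T dev x t).1.pull (action N L T dev x t)).advance
      (action N L T dev x t)).activate N L T := rfl

theorem action_of_pending {t : ℕ} {b : Joint M d} {rest : List (Joint M d)}
    (h : (run N L T dev x t).1.pending = b :: rest) : action N L T dev x t = b := by
  funext i
  rw [action, playerArm]
  simp [h]

open Classical in
theorem action_of_waiting {t : ℕ} {c : Joint M d} {w : List (Joint M d)}
    (hp : (run N L T dev x t).1.pending = []) (hw : (run N L T dev x t).1.waiting = c :: w)
    (i : Fin M) : action N L T dev x t i =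
      if ∃ a ∈ (run N L T dev x t).1.active,
        (run N L T dev x t).2 i c / (run N L T dev x t).1.count c +
            2 * eps T ((run N L T dev x t).1.count c) <
          (run N L T dev x t).2 i a / (run N L T dev x t).1.count a -
            eps T ((run N L T dev x t).1.count a)
      then dev i t c else c i := by
  rw [action, playerArm]
  simp only [hp, hw]

theorem action_zero : action N L T dev x 0 = center := by
  funext i
  -- The only active arm is compared with itself, and `2ε < -ε` is impossible.
  rw [action_of_waiting (c := center) (w := []) rfl rfl, if_neg]
  simp [run, PublicState.init]
  linarith [eps_nonneg T 0]

/-- The induction starts after the first round, because before it the centre has no pulls and `m ≥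
1` fails. With one pull the gap bound is trivial, since gaps are at most 1 and `log T ≥ 1/2`. -/
theorem invariant_one (hL : 0 < L) (hT : 2 ≤ T)
    (hμ1 : ∀ a, 0 ≤ μ a ∧ μ a ≤ 1) :
    ∃ m, Invariant N L T μ (run N L T dev x 1).1 m m (gap μ (action N L T dev x 0)) 1 ∧
      (run N L T dev x 1).1.waiting ≠ [] ∧ ((run N L T dev x 1).1.pending = [] →
        ∀ y, (run N L T dev x 1).1.Covered N L T y) := by
  classical
  rw [run_succ_fst, action_zero]
  have heq : ((run N L T dev x 0).1.pull center).advance center =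
      { (PublicState.init : PublicState M d).pull center with
        served := [], waiting := [center] } := by
    rw [PublicState.advance]
    simp [run, PublicState.init, PublicState.pull]
  rw [heq]
  have hvc : PublicState.vcount
      { (PublicState.init : PublicState M d).pull center with
        served := [], waiting := [center] } center = 1 := by
    simp [PublicState.vcount, PublicState.init, PublicState.pull]
  have hsq : ∀ y, gap μ y ^ 2 * (1 : ℕ) ≤ 600 * Real.log T := fun y => by
    have h1 := gap_nonneg (fun a => (hμ1 a).2) y
    have h2 := gap_le_one hμ1 y
    have h3 := half_le_log hT
    push_cast
    nlinarith
  refine ⟨1, Invariant.activate ?_ hL (by simp)⟩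
  refine
  { one_le := le_rfl
    onGrid := ?_
    count_eq_zero := ?_
    served_sub := by simp
    waiting_sub := by simp [PublicState.init, PublicState.pull]
    pending_sub := by simp [PublicState.init, PublicState.pull]
    nodup := by simp
    waiting_eq := ?_
    served_eq := by simp
    eliminated := by simp [PublicState.init, PublicState.pull]
    bound := ?_
    uncovered := fun y => Or.inr (hsq y)
    separated := by simp [PublicState.init, PublicState.pull]
    total := by simp [PublicState.init, PublicState.pull]
    cost := ⟨∅, by simp, by simp [PublicState.init, PublicState.pull]⟩ }
  · intro a ha
    rw [List.mem_singleton.1 ha]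
    exact onGrid_center
  · intro a _ ha
    exact PublicState.pull_count_of_ne fun h : a = center => ha (List.mem_singleton.2 h)
  · intro a ha
    rw [List.mem_singleton.1 ha]
    exact hvc
  · intro a ha
    rw [List.mem_singleton.1 ha, hvc]
    exact hsq _

theorem invariant_run (hM : 1 ≤ M) (hL : 0 < L) (hT : 2 ≤ T)
    (hμ1 : ∀ a, 0 ≤ μ a ∧ μ a ≤ 1) (hμ : ∀ a b, |μ a - μ b| ≤ L * armDist N a b)
    (hdev : ∀ i t c, OffGrid (dev i t c)) (hx : Clean N L T dev μ x) (t : ℕ) (ht : t < T) :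
    ∃ m, Invariant N L T μ (run N L T dev x (t + 1)).1 m m
        (∑ s ∈ Finset.range (t + 1), gap μ (action N L T dev x s)) (t + 1) ∧
      (run N L T dev x (t + 1)).1.waiting ≠ [] ∧ ((run N L T dev x (t + 1)).1.pending = [] →
        ∀ y, (run N L T dev x (t + 1)).1.Covered N L T y) := by
  induction t with
  | zero => simpa using invariant_one (dev := dev) (x := x) hL hT hμ1
  | succ t ih =>
    obtain ⟨m, h, hw, hcov⟩ := ih (by omega)
    suffices H : ∃ m', Invariant N L T μ (((run N L T dev x (t + 1)).1.pull
        (action N L T dev x (t + 1))).advance (action N L T dev x (t + 1))) m' m'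
        (∑ s ∈ Finset.range (t + 1), gap μ (action N L T dev x s) +
          gap μ (action N L T dev x (t + 1))) (t + 1 + 1) ∧
        (((run N L T dev x (t + 1)).1.pull
          (action N L T dev x (t + 1))).advance (action N L T dev x (t + 1))).waiting ≠ [] by
      obtain ⟨m', h', hw'⟩ := H
      rw [run_succ_fst, Finset.sum_range_succ]
      exact ⟨m', h'.activate hL hw'⟩
    cases hp : (run N L T dev x (t + 1)).1.pending with
    | cons b rest =>
      rw [action_of_pending hp]
      exact h.catchUp hw hp
    | nil =>
      obtain ⟨c, w, hcw⟩ := List.exists_cons_of_ne_nil hw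
      have hcov := hcov hp
      have hact := action_of_waiting hp hcw
      have hclean := hx (t + 1) ht
      have hv := PublicState.vcount_of_pending_eq_nil hp
      have hpos : ∀ a ∈ (run N L T dev x (t + 1)).1.active,
          1 ≤ (run N L T dev x (t + 1)).1.count a := fun a ha => hv a ▸ h.one_le_vcount ha
      have hcw' : c ∈ (run N L T dev x (t + 1)).1.waiting := by simp [hcw]
      have hca := h.waiting_sub c hcw'
      have hcm : (run N L T dev x (t + 1)).1.count c = m := by rw [← hv, h.waiting_eq c hcw']
      by_cases hA : action N L T dev x (t + 1) = c
      · rw [hA]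
        refine h.keep hL (fun a => (hμ1 a).2) hμ hp hcw hcov ?_
        -- One silent player suffices. His component of `c` was played and is dyadic, so he did not
        -- signal and his test failed for every active arm.
        let j : Fin M := ⟨0, hM⟩
        have hj := hact j
        rw [hA] at hj
        split_ifs at hj with hdv
        · exact absurd (hj ▸ hdev j (t + 1) c) (h.onGrid c hca j)
        push Not at hdv
        obtain ⟨y, hy⟩ := exists_gap_eq_zero N hL hμ
        obtain ⟨a, ha, hya⟩ := hcov y
        have hya := hya.resolve_left (by have := hpos a ha; omega)
        rw [armDist_comm, le_div_iff₀' hL] at hya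
        have hga := gap_le_gap_add hμ a y
        -- The gap of `a` is at most its radius, so `a` is still desired and has `m` or `m + 1`
        -- pulls. Of the six radii in the bound for `c`, three come from the test, one from each of
        -- the two estimates and one from the gap of `a`.
        have hma : m ≤ (run N L T dev x (t + 1)).1.count a := by
          by_contra hlt
          refine absurd (h.eliminated a ha (fun hs => hlt ?_) fun hs => hlt ?_).2 (by linarith)
          · rw [← hv, h.served_eq a hs]; omega
          · rw [← hv, h.waiting_eq a hs]
        have he := eps_anti T h.one_le hma
        have h1 := hdv a ha
        have h2 := (abs_le.1 (hclean j a (hpos a ha))).1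
        have h3 := (abs_le.1 (hclean j c (hpos c hca))).2
        rw [hcm] at h1 h3
        have h4 : gap μ c - gap μ a = μ a - μ c := by rw [gap, gap]; ring
        linarith
      · obtain ⟨j, hj⟩ := Function.ne_iff.1 hA
        have hj' := hact j
        split_ifs at hj' with hdv
        swap
        · exact absurd hj' hj
        refine h.drop hL hT hμ1 hμ hp hcw hcov ?_ (A := action N L T dev x (t + 1)) ?_
        -- The radius of `a` cancels and one radius of `c` remains: `μ a - μ c > eps T m`.
        · obtain ⟨a, ha, h1⟩ := hdv
          have h2 := (abs_le.1 (hclean j a (hpos a ha))).2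
          have h3 := (abs_le.1 (hclean j c (hpos c hca))).1
          rw [hcm] at h1 h3
          have h4 : gap μ c - gap μ a = μ a - μ c := by rw [gap, gap]; ring
          linarith [gap_nonneg (fun a => (hμ1 a).2) a]
        · exact fun hg => hg j (hj' ▸ hdev j (t + 1) c)

end

/-! ### From covering numbers to the regret -/

section

variable {N : Seminorm ℝ (Fin M → Fin d → ℝ)} {L : ℝ} {T : ℕ} {μ : Joint M d → ℝ} {z c : ℝ}

theorem ZoomingBound.nonneg (h : ZoomingBound N L μ z c) : 0 ≤ c := by
  obtain ⟨n, hn, -⟩ := h 1 one_pos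
  rw [Real.one_rpow, div_one] at hn
  exact n.cast_nonneg.trans hn

/-- Arms in one covering set are more than `r / (10 L)` apart, which is `3/10` of its diameter bound
`r / (3 L)`. The packing bound thus applies to each covering set. -/
theorem ZoomingBound.card_le (h : ZoomingBound N L μ z c) (hN : ∀ v, N v = 0 → v = 0)
    (hL : 0 < L) (F : Finset (Joint M d)) {r : ℝ} (hr : 0 < r)
    (hF : ∀ a ∈ F, r ≤ gap μ a ∧ gap μ a < 2 * r)
    (hsep : ∀ a ∈ F, ∀ b ∈ F, a ≠ b → min (gap μ a) (gap μ b) / 10 < L * armDist N a b) :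
    (F.card : ℝ) ≤ 8 ^ (M * d) * (c / r ^ z) := by
  classical
  obtain ⟨n, hn, U, hU, hcov⟩ := h r hr
  have hsub : F ⊆ Finset.univ.biUnion fun j => F.filter (· ∈ U j) := by
    intro a ha
    obtain ⟨j, hj⟩ := Set.mem_iUnion.1 (hcov (hF a ha))
    exact Finset.mem_biUnion.2 ⟨j, Finset.mem_univ _, Finset.mem_filter.2 ⟨ha, hj⟩⟩
  have hcard : ∀ j, ((F.filter (· ∈ U j)).card : ℝ) ≤ 8 ^ (M * d) := by
    intro j
    refine card_joint_le_of_separated N hN _ (ρ := r / (3 * L)) (by positivity) ?_ ?_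
    · intro x hx y hy
      exact hU j x (Finset.mem_filter.1 hx).2 y (Finset.mem_filter.1 hy).2
    · intro x hx y hy hxy
      have hx := (Finset.mem_filter.1 hx).1
      have hy := (Finset.mem_filter.1 hy).1
      have h1 := hsep x hx y hy hxy
      have h2 := le_min (hF x hx).1 (hF y hy).1
      have h3 : 3 / 10 * (r / (3 * L)) = r / 10 / L := by field_simp
      rw [h3, div_le_iff₀' hL]
      linarith
  calc (F.card : ℝ) ≤ ∑ j, ((F.filter (· ∈ U j)).card : ℝ) := by
        exact_mod_cast (Finset.card_le_card hsub).trans Finset.card_biUnion_le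
    _ ≤ ∑ _j : Fin n, (8 : ℝ) ^ (M * d) := Finset.sum_le_sum fun j _ => hcard j
    _ = 8 ^ (M * d) * n := by simp [mul_comm]
    _ ≤ 8 ^ (M * d) * (c / r ^ z) := by gcongr

/-- The cost of well separated arms that are pulled rarely enough for their gaps. -/
theorem ZoomingBound.sum_le (h : ZoomingBound N L μ z c) (hN : ∀ v, N v = 0 → v = 0)
    (hL : 0 < L) (hz : 0 ≤ z) (hμ1 : ∀ a, 0 ≤ μ a ∧ μ a ≤ 1) (F : Finset (Joint M d))
    (n : Joint M d → ℕ) (hn : ∀ a ∈ F, gap μ a ^ 2 * n a ≤ 600 * Real.log T)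
    (hT : ∑ a ∈ F, n a ≤ T)
    (hsep : ∀ a ∈ F, ∀ b ∈ F, a ≠ b → min (gap μ a) (gap μ b) / 10 < L * armDist N a b)
    {δ : ℝ} (hδ : 0 < δ) :
    ∑ a ∈ F, gap μ a * n a ≤
      δ * T + 1200 * 8 ^ (M * d) * (c * Real.log T / δ ^ (z + 1)) := by
  classical
  -- Gaps are at most 1, so the scales `2 ^ i * δ` with `i < I` catch every gap from `δ` on.
  obtain ⟨I, hI⟩ := pow_unbounded_of_one_lt (1 / δ) (by norm_num : (1 : ℝ) < 2)
  have hg0 : ∀ a, 0 ≤ gap μ a := gap_nonneg fun a => (hμ1 a).2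
  have hc := h.nonneg
  have hl := log_nonneg_of_horizon T
  let P : ℕ → Joint M d → Prop := fun i a => 2 ^ i * δ ≤ gap μ a ∧ gap μ a < 2 * (2 ^ i * δ)
  have hpt : ∀ a, gap μ a * n a ≤ δ * n a +
      ∑ i ∈ Finset.range I, if P i a then gap μ a * n a else 0 := by
    intro a
    have hnn : ∀ i ∈ Finset.range I, 0 ≤ if P i a then gap μ a * n a else 0 := fun i _ => by
      have := hg0 a
      split_ifs <;> positivity
    rcases lt_or_ge (gap μ a) δ with hlt | hge
    · have := Finset.sum_nonneg hnn
      have : gap μ a * n a ≤ δ * n a := by gcongr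
      linarith
    · obtain ⟨i, hi, hi'⟩ := exists_nat_pow_near ((one_le_div hδ).2 hge)
        (by norm_num : (1 : ℝ) < 2)
      rw [le_div_iff₀ hδ] at hi
      rw [div_lt_iff₀ hδ, pow_succ] at hi'
      have hiI : i < I := by
        refine (pow_lt_pow_iff_right₀ (by norm_num : (1 : ℝ) < 2)).1 (lt_of_le_of_lt ?_ hI)
        rw [le_div_iff₀ hδ]
        exact hi.trans (gap_le_one hμ1 a)
      have := Finset.single_le_sum hnn (Finset.mem_range.2 hiI)
      rw [if_pos ⟨hi, by linarith⟩] at this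
      have : 0 ≤ δ * n a := by positivity
      linarith
  have hscale : ∀ i, ∑ a ∈ F with P i a, gap μ a * n a ≤
      600 * 8 ^ (M * d) * (c * Real.log T / δ ^ (z + 1)) * (1 / 2) ^ i := by
    intro i
    set r : ℝ := 2 ^ i * δ with hr
    have hr0 : 0 < r := by positivity
    have hcard := h.card_le hN hL (F.filter (P i)) hr0
      (fun a ha => (Finset.mem_filter.1 ha).2)
      fun a ha b hb => hsep a (Finset.mem_filter.1 ha).1 b (Finset.mem_filter.1 hb).1
    calc ∑ a ∈ F with P i a, gap μ a * n a
        ≤ ∑ a ∈ F with P i a, 600 * Real.log T / r := by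
          refine Finset.sum_le_sum fun a ha => ?_
          obtain ⟨ha, hP⟩ := Finset.mem_filter.1 ha
          rw [le_div_iff₀ hr0]
          calc gap μ a * n a * r ≤ gap μ a * n a * gap μ a := by
                have := hg0 a
                gcongr
                exact hP.1
            _ = gap μ a ^ 2 * n a := by ring
            _ ≤ _ := hn a ha
      _ = (F.filter (P i)).card * (600 * Real.log T / r) := by simp
      _ ≤ 8 ^ (M * d) * (c / r ^ z) * (600 * Real.log T / r) := by gcongr
      -- The factor `1 / r` alone provides the geometric decay; `r ^ z` is merely replaced by `δ ^
      -- z`, so `z = 0` needs no separate treatment.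
      _ ≤ 8 ^ (M * d) * (c / δ ^ z) * (600 * Real.log T / r) := by
          gcongr
          rw [hr]
          exact le_mul_of_one_le_left hδ.le (one_le_pow₀ (by norm_num))
      _ = _ := by
          rw [Real.rpow_add hδ, Real.rpow_one, hr, one_div, inv_pow]
          field_simp
  calc ∑ a ∈ F, gap μ a * n a
      ≤ ∑ a ∈ F, (δ * n a + ∑ i ∈ Finset.range I, if P i a then gap μ a * n a else 0) :=
        Finset.sum_le_sum fun a _ => hpt a
    _ = δ * (∑ a ∈ F, n a : ℕ) + ∑ i ∈ Finset.range I, ∑ a ∈ F with P i a, gap μ a * n a := by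
        rw [Finset.sum_add_distrib, Finset.sum_comm, ← Finset.mul_sum, Nat.cast_sum]
        congr 1
        exact Finset.sum_congr rfl fun i _ => (Finset.sum_filter _ _).symm
    _ ≤ δ * T + ∑ i ∈ Finset.range I,
          600 * 8 ^ (M * d) * (c * Real.log T / δ ^ (z + 1)) * (1 / 2) ^ i := by
        gcongr with i
        exact hscale i
    _ ≤ δ * T + 600 * 8 ^ (M * d) * (c * Real.log T / δ ^ (z + 1)) * 2 := by
        rw [← Finset.mul_sum]
        gcongr
        exact (summable_geometric_two.sum_le_tsum _ fun i _ => by positivity).trans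
          tsum_geometric_two.le
    _ = _ := by ring

/-- Every gap is dominated by the regret bound. -/
theorem ZoomingBound.gap_le (h : ZoomingBound N L μ z c) (hz : 0 ≤ z) (hT : 2 ≤ T)
    (hμ1 : ∀ a, 0 ≤ μ a ∧ μ a ≤ 1) (a : Joint M d) :
    gap μ a ≤ 2 * ((T : ℝ) ^ ((z + 1) / (z + 2)) * (c * Real.log T) ^ (1 / (z + 2))) := by
  have hc := h.nonneg
  have hl := half_le_log hT
  have hT1 : (1 : ℝ) ≤ (T : ℝ) ^ ((z + 1) / (z + 2)) :=
    Real.one_le_rpow (by exact_mod_cast (by omega : 1 ≤ T)) (by positivity)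
  have hcl : 0 ≤ c * Real.log T := by positivity
  rcases (gap_nonneg (fun a => (hμ1 a).2) a).eq_or_lt with h0 | h0
  · rw [← h0]
    positivity
  set g := gap μ a with hg
  have hgz : 0 < g ^ z := Real.rpow_pos_of_pos h0 z
  -- The set of arms at scale `g` contains `a`, so at least one covering set is needed. This ties
  -- every gap to the multiplier, even when `c` is very small.
  have hcz : g ^ z ≤ c := by
    obtain ⟨n, hn, U, -, hcov⟩ := h g h0
    have : n ≠ 0 := by
      rintro rfl
      obtain ⟨j, -⟩ := Set.mem_iUnion.1 (hcov (⟨hg.le, by linarith⟩ : g ≤ gap μ a ∧ _))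
      exact j.elim0
    have : (1 : ℝ) ≤ n := by exact_mod_cast Nat.one_le_iff_ne_zero.2 this
    have := this.trans hn
    rwa [le_div_iff₀ hgz, one_mul] at this
  have h1 : (g / 2) ^ (z + 2) ≤ c * Real.log T := by
    rw [Real.rpow_add (by positivity), Real.rpow_two, Real.div_rpow h0.le (by norm_num)]
    have h2 : (1 : ℝ) ≤ 2 ^ z := Real.one_le_rpow (by norm_num) hz
    have h3 : g ≤ 1 := gap_le_one hμ1 a
    calc g ^ z / 2 ^ z * (g / 2) ^ 2 ≤ g ^ z * (1 / 2) := by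
          gcongr
          · exact div_le_self hgz.le h2
          · nlinarith
      _ ≤ c * Real.log T := by gcongr
  have h2 : g / 2 ≤ (c * Real.log T) ^ (1 / (z + 2)) := by
    have := Real.rpow_le_rpow (by positivity) h1 (by positivity : 0 ≤ 1 / (z + 2))
    rwa [← Real.rpow_mul (by positivity), mul_one_div_cancel (by positivity),
      Real.rpow_one] at this
  have h3 : g / 2 ≤ (T : ℝ) ^ ((z + 1) / (z + 2)) * (c * Real.log T) ^ (1 / (z + 2)) :=
    h2.trans (le_mul_of_one_le_left (by positivity) hT1)
  linarith

/-- Each eliminated arm pays for one signal round with its own pulls, so the charges at most double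
the sum. The bound passes from `vcount` to the actual counts, which are smaller during a catch-up.
-/
theorem Invariant.le_sum {p : PublicState M d} {m k t : ℕ} {G : ℝ}
    (h : Invariant N L T μ p m k G t) (hμ1 : ∀ a, μ a ≤ 1) :
    ∃ F : Finset (Joint M d), G ≤ 2 * ∑ a ∈ F, gap μ a * p.count a ∧ ∑ a ∈ F, p.count a ≤ t ∧
      (∀ a ∈ F, gap μ a ^ 2 * p.count a ≤ 600 * Real.log T) ∧
      ∀ a ∈ F, ∀ b ∈ F, a ≠ b → min (gap μ a) (gap μ b) / 10 < L * armDist N a b := by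
  classical
  obtain ⟨Q, hQ, hG⟩ := h.cost
  refine ⟨p.active.toFinset, ?_, h.total, fun a ha => ?_, fun a ha b hb hab => ?_⟩
  · have : ∑ a ∈ Q, gap μ a * p.count a ≤ ∑ a ∈ p.active.toFinset, gap μ a * p.count a := by
      refine Finset.sum_le_sum_of_subset_of_nonneg
        (fun a ha => List.mem_toFinset.2 (hQ a ha).1) fun a _ _ => ?_
      have := gap_nonneg hμ1 a
      positivity
    linarith
  · refine le_trans ?_ (h.bound a (List.mem_toFinset.1 ha))
    gcongr
    exact Nat.le_add_right _ _
  · have hs : p.active.Pairwise fun a b =>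
        min (gap μ a) (gap μ b) / 10 < L * armDist N a b := by
      refine h.separated.imp fun {a b} hab => ?_
      rw [armDist_comm]
      exact lt_of_le_of_lt (by gcongr; exact min_le_left _ _) hab
    have : Std.Symm fun a b => min (gap μ a) (gap μ b) / 10 < L * armDist N a b :=
      ⟨fun a b hab => by rwa [min_comm, armDist_comm]⟩
    exact hs.forall (List.mem_toFinset.1 ha) (List.mem_toFinset.1 hb) hab

/-- The total gap of a run on the clean event. -/
theorem sum_gap_le_of_clean (hM : 1 ≤ M) (hN : ∀ v, N v = 0 → v = 0) (hL : 0 < L) (hT : 2 ≤ T)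
    {dev : Fin M → ℕ → Joint M d → Arm d} {x : ℕ → Fin M → Joint M d → ℝ}
    (hμ1 : ∀ a, 0 ≤ μ a ∧ μ a ≤ 1) (hμ : ∀ a b, |μ a - μ b| ≤ L * armDist N a b)
    (hdev : ∀ i t c, OffGrid (dev i t c)) (hx : Clean N L T dev μ x)
    (hz : 0 ≤ z) (h : ZoomingBound N L μ z c) :
    ∑ s ∈ Finset.range T, gap μ (action N L T dev x s) ≤ (2 + 2400 * 8 ^ (M * d)) *
      ((T : ℝ) ^ ((z + 1) / (z + 2)) * (c * Real.log T) ^ (1 / (z + 2))) := by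
  -- For `c = 0` the balancing `δ` would vanish, but then all gaps vanish as well.
  rcases h.nonneg.eq_or_lt with hc | hc
  · have h0 : ∀ a, gap μ a ≤ 0 := fun a => by
      have := h.gap_le hz hT hμ1 a
      rw [← hc, zero_mul, Real.zero_rpow (by positivity), mul_zero, mul_zero] at this
      exact this
    refine (Finset.sum_nonpos fun s _ => h0 _).trans ?_
    have := log_nonneg_of_horizon T
    rw [← hc]
    positivity
  obtain ⟨m, hinv, -⟩ := invariant_run hM hL hT hμ1 hμ hdev hx (T - 1) (by omega)
  rw [Nat.sub_add_cancel (by omega)] at hinv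
  obtain ⟨F, hG, htot, hbd, hsep⟩ := hinv.le_sum fun a => (hμ1 a).2
  have hl := half_le_log hT
  have hT0 : (0 : ℝ) < T := by positivity
  have hcl : 0 < c * Real.log T := by positivity
  -- This `δ` solves `δ * T = c * log T / δ ^ (z + 1)`.
  set δ : ℝ := (c * Real.log T / T) ^ (1 / (z + 2)) with hδ
  have hδ0 : 0 < δ := by positivity
  have hz2 : (0 : ℝ) < z + 2 := by positivity
  have hB : δ * T = (T : ℝ) ^ ((z + 1) / (z + 2)) * (c * Real.log T) ^ (1 / (z + 2)) := by
    have : (z + 1) / (z + 2) = 1 - 1 / (z + 2) := by field_simp; ring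
    rw [hδ, Real.div_rpow hcl.le hT0.le, this, Real.rpow_sub hT0, Real.rpow_one]
    ring
  have hpow : δ ^ (z + 1) * δ = c * Real.log T / T := by
    rw [← Real.rpow_add_one hδ0.ne', hδ, ← Real.rpow_mul (by positivity)]
    have : 1 / (z + 2) * (z + 1 + 1) = 1 := by field_simp; ring
    rw [this, Real.rpow_one]
  have hB' : c * Real.log T / δ ^ (z + 1) = δ * T := by
    rw [div_eq_iff (by positivity)]
    rw [eq_div_iff hT0.ne'] at hpow
    rw [← hpow]
    ring
  have hs := h.sum_le hN hL hz hμ1 F _ hbd htot hsep hδ0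
  rw [hB', hB] at hs
  linarith

end

/-! ### Counts and reward sums along a run -/

section

variable {N : Seminorm ℝ (Fin M → Fin d → ℝ)} {L : ℝ} {T : ℕ}
  {dev : Fin M → ℕ → Joint M d → Arm d} {x : ℕ → Fin M → Joint M d → ℝ}

theorem PublicState.advance_count (p : PublicState M d) (a : Joint M d) :
    (p.advance a).count = p.count := by
  rw [advance]
  split
  · rfl
  · split
    · rfl
    · dsimp only
      split_ifs <;> rfl

theorem PublicState.activate_count (p : PublicState M d) :
    (p.activate N L T).count = p.count := by
  rw [activate]
  split_ifs <;> rfl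

open Classical in
theorem run_count_succ (t : ℕ) (a : Joint M d) : (run N L T dev x (t + 1)).1.count a =
    (run N L T dev x t).1.count a + if action N L T dev x t = a then 1 else 0 := by
  rw [run_succ_fst, PublicState.activate_count, PublicState.advance_count]
  split_ifs with h
  · rw [h, PublicState.pull_count_self]
  · rw [PublicState.pull_count_of_ne (Ne.symm h), add_zero]

open Classical in
theorem run_sum_succ (t : ℕ) (i : Fin M) (a : Joint M d) : (run N L T dev x (t + 1)).2 i a =
    (run N L T dev x t).2 i a + if action N L T dev x t = a then x t i a else 0 := by
  change Function.update ((run N L T dev x t).2 i) (action N L T dev x t)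
    ((run N L T dev x t).2 i (action N L T dev x t) + x t i (action N L T dev x t)) a = _
  split_ifs with h
  · rw [h, Function.update_self]
  · rw [Function.update_of_ne (Ne.symm h), add_zero]

theorem run_count_le (t : ℕ) (a : Joint M d) : (run N L T dev x t).1.count a ≤ t := by
  induction t with
  | zero => rfl
  | succ t ih =>
    rw [run_count_succ]
    split_ifs <;> omega

theorem run_count_mono (a : Joint M d) : Monotone fun t => (run N L T dev x t).1.count a :=
  monotone_nat_of_le_succ fun t => by
    rw [run_count_succ]
    omega

theorem run_sum_eq_zero (i : Fin M) (a : Joint M d) (t : ℕ)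
    (h : (run N L T dev x t).1.count a = 0) : (run N L T dev x t).2 i a = 0 := by
  induction t with
  | zero => rfl
  | succ t ih =>
    rw [run_count_succ] at h
    rw [run_sum_succ, ih (by omega), if_neg, add_zero]
    intro h'
    rw [if_pos h'] at h
    omega

theorem exists_first_pull (a : Joint M d) (t : ℕ) (h : 1 ≤ (run N L T dev x t).1.count a) :
    ∃ s < t, action N L T dev x s = a ∧ (run N L T dev x s).1.count a = 0 := by
  induction t with
  | zero => exact absurd h (by simp [run, PublicState.init])
  | succ t ih =>
    rcases Nat.eq_zero_or_pos ((run N L T dev x t).1.count a) with h0 | h0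
    · refine ⟨t, by omega, ?_, h0⟩
      by_contra hne
      rw [run_count_succ, h0, if_neg hne] at h
      omega
    · obtain ⟨s, hs, h'⟩ := ih h0
      exact ⟨s, by omega, h'⟩

open Classical in
/-- The exponential weights of the rewards of player `j` from the first `n` pulls of `a` in the
rounds from `s` to `u`. -/
noncomputable def expWeight (N : Seminorm ℝ (Fin M → Fin d → ℝ)) (L : ℝ) (T : ℕ)
    (dev : Fin M → ℕ → Joint M d → Arm d) (x : ℕ → Fin M → Joint M d → ℝ) (j : Fin M)
    (a : Joint M d) (m l : ℝ) (n s u : ℕ) : ENNReal :=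
  ∏ v ∈ Finset.Ico s u,
    if action N L T dev x v = a ∧ (run N L T dev x v).1.count a < n
    then ENNReal.ofReal (Real.exp (l * (x v j a - m) - l ^ 2 / 2)) else 1

/-- Up to `n` pulls the cap is inactive, so each pull of `a` since round `s` contributes its factor.
No pull precedes `s`, so the exponents add up to the full reward sum. -/
theorem expWeight_eq (j : Fin M) (a : Joint M d) (m l : ℝ) (n s u : ℕ) (hsu : s ≤ u)
    (hs : (run N L T dev x s).1.count a = 0) (hu : (run N L T dev x u).1.count a ≤ n) :
    expWeight N L T dev x j a m l n s u = ENNReal.ofReal (Real.exp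
      (l * ((run N L T dev x u).2 j a - (run N L T dev x u).1.count a * m) -
        l ^ 2 * (run N L T dev x u).1.count a / 2)) := by
  induction u, hsu using Nat.le_induction with
  | base => simp [expWeight, hs, run_sum_eq_zero j a s hs]
  | succ u hsu ih =>
    rw [expWeight, Finset.prod_Ico_succ_top hsu, ← expWeight,
      ih ((run_count_mono a (Nat.le_succ u)).trans hu)]
    rw [run_count_succ] at hu
    rw [run_count_succ, run_sum_succ]
    by_cases h : action N L T dev x u = a
    · rw [if_pos h] at hu
      rw [if_pos ⟨h, by omega⟩, if_pos h, if_pos h, ← ENNReal.ofReal_mul (Real.exp_nonneg _),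
        ← Real.exp_add]
      congr 2
      push_cast
      ring
    · rw [if_neg fun h' => h h'.1, if_neg h, if_neg h, mul_one, add_zero, add_zero]

/-- After `n` pulls all further factors are 1. A failure at a random round can thus be read off at
the fixed round `T`. -/
theorem expWeight_eq_of_le (j : Fin M) (a : Joint M d) (m l : ℝ) (n s t u : ℕ) (hst : s ≤ t)
    (htu : t ≤ u) (ht : n ≤ (run N L T dev x t).1.count a) :
    expWeight N L T dev x j a m l n s u = expWeight N L T dev x j a m l n s t := by
  rw [expWeight, ← Finset.prod_Ico_consecutive _ hst htu, ← expWeight]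
  convert mul_one _
  refine Finset.prod_eq_one fun v hv => if_neg fun h => ?_
  have := run_count_mono (N := N) (L := L) (T := T) (dev := dev) (x := x) a (Finset.mem_Ico.1 hv).1
  have := h.2
  simp only at *
  omega

/-- If a confidence bound fails, then one of the exponential weights is large. -/
theorem exists_large_expWeight {μ : Joint M d → ℝ} (hT : 2 ≤ T) (h : ¬ Clean N L T dev μ x) :
    ∃ s < T, ∃ n < T, ∃ j, ∃ σ ∈ ({1, -1} : Finset ℝ), ∃ a, action N L T dev x s = a ∧
      (run N L T dev x s).1.count a = 0 ∧
      (T : ENNReal) ^ 3 ≤ expWeight N L T dev x j a (μ a) (σ * eps T n) n s T := by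
  rw [Clean] at h
  push Not at h
  obtain ⟨t, ht, j, a, h1, hlt⟩ := h
  obtain ⟨s, hs, hsa, hs0⟩ := exists_first_pull a t h1
  set n := (run N L T dev x t).1.count a with hn
  set S := (run N L T dev x t).2 j a with hS
  have hn0 : (0 : ℝ) < n := by exact_mod_cast h1
  have hT0 : (0 : ℝ) < T := by positivity
  -- With the parameter `σ * eps T n` the exponent is at least `ε² n - ε² n / 2 = 3 log T`; the
  -- constant 6 in `eps` gives this third power.
  have key : ∀ σ : ℝ, σ ^ 2 = 1 → eps T n < σ * (S / n - μ a) →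
      (T : ENNReal) ^ 3 ≤ expWeight N L T dev x j a (μ a) (σ * eps T n) n s T := by
    intro σ hσ hlt
    rw [expWeight_eq_of_le j a _ _ n s t T hs.le ht.le le_rfl,
      expWeight_eq j a _ _ n s t hs.le hs0 le_rfl, ← ENNReal.ofReal_natCast,
      ← ENNReal.ofReal_pow hT0.le]
    refine ENNReal.ofReal_le_ofReal ?_
    rw [← Real.exp_log (pow_pos hT0 3), Real.log_pow]
    refine Real.exp_le_exp.2 ?_
    rw [← hn, ← hS, mul_pow, hσ]
    have h2 : S - n * μ a = n * (S / n - μ a) := by field_simp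
    have h3 := eps_sq_mul (T := T) h1
    have h4 : eps T n * eps T n * n ≤ eps T n * (σ * (S / n - μ a)) * n := by
      have := eps_nonneg T n
      gcongr
    rw [h2]
    push_cast
    nlinarith
  refine ⟨s, hs.trans ht, n, (run_count_le t a).trans_lt ht, j, ?_⟩
  rcases lt_abs.1 hlt with hlt | hlt
  · exact ⟨1, by simp, a, hsa, hs0, key 1 (by norm_num) (by linarith)⟩
  · exact ⟨-1, by simp, a, hsa, hs0, key (-1) (by norm_num) (by linarith)⟩

end

/-! ### Measurability of the run -/

section

variable {Ω α β : Type*}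

/-- `f` takes finitely many values, each on a measurable set. -/
def FinMeas (m : MeasurableSpace Ω) (f : Ω → α) : Prop :=
  (Set.range f).Finite ∧ ∀ y, MeasurableSet[m] (f ⁻¹' {y})

variable {m : MeasurableSpace Ω}

theorem FinMeas.preimage {f : Ω → α} (hf : FinMeas m f) (S : Set α) :
    MeasurableSet[m] (f ⁻¹' S) := by
  have : f ⁻¹' S = ⋃ y ∈ Set.range f ∩ S, f ⁻¹' {y} := by
    ext ω
    simp
  rw [this]
  exact MeasurableSet.biUnion (hf.1.inter_of_left S).countable fun y _ => hf.2 y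

theorem FinMeas.comp {f : Ω → α} (hf : FinMeas m f) (g : α → β) :
    FinMeas m fun ω => g (f ω) :=
  ⟨(hf.1.image g).subset (by rintro _ ⟨ω, rfl⟩; exact ⟨_, ⟨ω, rfl⟩, rfl⟩),
    fun y => hf.preimage (g ⁻¹' {y})⟩

theorem FinMeas.mono {m' : MeasurableSpace Ω} (h : m ≤ m') {f : Ω → α} (hf : FinMeas m f) :
    FinMeas m' f := ⟨hf.1, fun y => h _ (hf.2 y)⟩

/-- The second map may depend on the value of the first and is examined with that value frozen. In
this way the players' choices need to be measurable only for a fixed public state. -/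
theorem FinMeas.pair {f : Ω → α} (hf : FinMeas m f) {g : α → Ω → β}
    (hg : ∀ y, FinMeas m (g y)) : FinMeas m fun ω => (f ω, g (f ω) ω) := by
  constructor
  · refine (hf.1.biUnion fun y _ => (hg y).1.image (Prod.mk y)).subset ?_
    rintro _ ⟨ω, rfl⟩
    exact Set.mem_biUnion ⟨ω, rfl⟩ ⟨_, ⟨ω, rfl⟩, rfl⟩
  · rintro ⟨y, y'⟩
    have : (fun ω => (f ω, g (f ω) ω)) ⁻¹' {(y, y')} = f ⁻¹' {y} ∩ g y ⁻¹' {y'} := by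
      ext ω
      simp only [Set.mem_preimage, Set.mem_singleton_iff, Prod.mk.injEq, Set.mem_inter_iff]
      constructor
      · rintro ⟨rfl, h⟩; exact ⟨rfl, h⟩
      · rintro ⟨rfl, h⟩; exact ⟨rfl, h⟩
    rw [this]
    exact (hf.2 y).inter ((hg y).2 y')

theorem FinMeas.pi {ι : Type*} [Finite ι] {f : ι → Ω → α} (hf : ∀ i, FinMeas m (f i)) :
    FinMeas m fun ω i => f i ω := by
  constructor
  · refine (Set.Finite.pi' fun i => (hf i).1).subset ?_
    rintro _ ⟨ω, rfl⟩ i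
    exact ⟨ω, rfl⟩
  · intro y
    have : (fun ω i => f i ω) ⁻¹' {y} = ⋂ i, f i ⁻¹' {y i} := by
      ext ω
      simp [funext_iff]
    rw [this]
    exact MeasurableSet.iInter fun i => (hf i).2 _

theorem FinMeas.const (y : α) : FinMeas m fun _ : Ω => y :=
  ⟨(Set.finite_singleton y).subset (by rintro _ ⟨ω, rfl⟩; rfl), fun _ => MeasurableSet.const _⟩

open Classical in
theorem FinMeas.ite {S : Set Ω} (hS : MeasurableSet[m] S) (y y' : α) :
    FinMeas m fun ω => if ω ∈ S then y else y' := by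
  constructor
  · refine (Set.toFinite {y, y'}).subset ?_
    rintro _ ⟨ω, rfl⟩
    dsimp only
    split_ifs <;> simp
  · intro w
    have : (fun ω => if ω ∈ S then y else y') ⁻¹' {w} =
        (S ∩ {_ω | y = w}) ∪ (Sᶜ ∩ {_ω | y' = w}) := by
      ext ω
      by_cases h : ω ∈ S <;> simp [h]
    rw [this]
    exact (hS.inter (MeasurableSet.const _)).union (hS.compl.inter (MeasurableSet.const _))

theorem FinMeas.playerArm (T : ℕ) (dev : Fin M → ℕ → Joint M d → Arm d) (t : ℕ)
    (p : PublicState M d) (i : Fin M) {S : Ω → Joint M d → ℝ}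
    (hS : ∀ a, Measurable[m] fun ω => S ω a) :
    FinMeas m fun ω => MZoomB.playerArm T dev t p i (S ω) := by
  classical
  unfold MZoomB.playerArm
  split
  · exact FinMeas.const _
  · split
    · exact FinMeas.const _
    · rename_i c _ _
      have hset : MeasurableSet[m] {ω | ∃ a ∈ p.active,
          S ω c / p.count c + 2 * eps T (p.count c) < S ω a / p.count a - eps T (p.count a)} := by
        have : {ω | ∃ a ∈ p.active, S ω c / p.count c + 2 * eps T (p.count c) <
            S ω a / p.count a - eps T (p.count a)} = ⋃ a ∈ {a | a ∈ p.active},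
            {ω | S ω c / p.count c + 2 * eps T (p.count c) <
              S ω a / p.count a - eps T (p.count a)} := by
          ext ω
          simp
        rw [this]
        refine MeasurableSet.biUnion (List.finite_toSet p.active).countable fun a _ => ?_
        exact measurableSet_lt (((hS c).div_const _).add_const _)
          (((hS a).div_const _).sub_const _)
      convert! FinMeas.ite hset _ _

/-- The events that depend on the rewards before round `t`. -/
@[reducible] def past (X : ℕ → Fin M → Joint M d → Ω → ℝ) (t : ℕ) : MeasurableSpace Ω :=
  ⨆ q ∈ {q : ℕ × Fin M | q.1 < t},
    MeasurableSpace.comap (fun ω a => X q.1 q.2 a ω) inferInstance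

theorem past_mono (X : ℕ → Fin M → Joint M d → Ω → ℝ) : Monotone (past X) := fun _ _ hst =>
  biSup_mono fun _ hq => lt_of_lt_of_le hq hst

theorem measurable_past (X : ℕ → Fin M → Joint M d → Ω → ℝ) {s t : ℕ} (h : s < t) (i : Fin M)
    (a : Joint M d) : Measurable[past X t] (X s i a) := by
  have h1 : Measurable[past X t] fun ω a => X s i a ω := by
    rw [measurable_iff_comap_le]
    exact le_biSup (fun q : ℕ × Fin M =>
      MeasurableSpace.comap (fun ω a => X q.1 q.2 a ω) inferInstance) (i := (s, i)) h
  exact (measurable_pi_apply a).comp h1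

variable {N : Seminorm ℝ (Fin M → Fin d → ℝ)} {L : ℝ} {T : ℕ}
  {dev : Fin M → ℕ → Joint M d → Arm d}

/-- Finitely many values make composition with an arbitrary function harmless, so no regularity of
the update `step` is needed. Only the private reward sums require genuine measurability. -/
theorem finMeas_run (X : ℕ → Fin M → Joint M d → Ω → ℝ) (t : ℕ) :
    FinMeas (past X t) (fun ω => (run N L T dev (fun s j a => X s j a ω) t).1) ∧
    FinMeas (past X t) (fun ω => ((run N L T dev (fun s j a => X s j a ω) t).1,
      action N L T dev (fun s j a => X s j a ω) t)) ∧
    ∀ i a, Measurable[past X t] fun ω => (run N L T dev (fun s j a => X s j a ω) t).2 i a := by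
  classical
  have hact : ∀ t, FinMeas (past X t)
        (fun ω => (run N L T dev (fun s j a => X s j a ω) t).1) →
      (∀ i a, Measurable[past X t]
        fun ω => (run N L T dev (fun s j a => X s j a ω) t).2 i a) →
      FinMeas (past X t) (fun ω => ((run N L T dev (fun s j a => X s j a ω) t).1,
        action N L T dev (fun s j a => X s j a ω) t)) := fun t h1 h2 =>
    h1.pair (g := fun p ω i =>
      MZoomB.playerArm T dev t p i ((run N L T dev (fun s j a => X s j a ω) t).2 i))
      fun p => FinMeas.pi fun i => FinMeas.playerArm T dev t p i (h2 i)
  induction t with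
  | zero =>
    have h1 : FinMeas (past X 0) fun ω => (run N L T dev (fun s j a => X s j a ω) 0).1 :=
      FinMeas.const _
    have h2 : ∀ i a, Measurable[past X 0]
        fun ω => (run N L T dev (fun s j a => X s j a ω) 0).2 i a := fun i a =>
      measurable_const
    exact ⟨h1, hact 0 h1 h2, h2⟩
  | succ t ih =>
    obtain ⟨h0, h1, h2⟩ := ih
    have hle := past_mono X (Nat.le_succ t)
    have h1' : FinMeas (past X (t + 1))
        fun ω => (run N L T dev (fun s j a => X s j a ω) (t + 1)).1 :=
      (h1.comp fun q => q.1.step N L T q.2).mono hle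
    have h2' : ∀ i a, Measurable[past X (t + 1)]
        fun ω => (run N L T dev (fun s j a => X s j a ω) (t + 1)).2 i a := by
      intro i a
      simp only [run_sum_succ]
      refine ((h2 i a).mono hle le_rfl).add (Measurable.ite ?_ ?_ measurable_const)
      · exact ((h1.comp Prod.snd).mono hle).2 a
      · exact measurable_past X (Nat.lt_succ_self t) i a
    exact ⟨h1', hact _ h1' h2', h2'⟩

theorem finMeas_action (X : ℕ → Fin M → Joint M d → Ω → ℝ) (t : ℕ) :
    FinMeas (past X t) fun ω => action N L T dev (fun s j a => X s j a ω) t :=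
  (finMeas_run X t).2.1.comp Prod.snd

end

/-! ### The clean event -/

section

variable {Ω : Type*} [MeasurableSpace Ω] {P : Measure Ω}
  {N : Seminorm ℝ (Fin M → Fin d → ℝ)} {L : ℝ} {T : ℕ}
  {dev : Fin M → ℕ → Joint M d → Arm d} {ν : Joint M d → Measure ℝ}
  {X : ℕ → Fin M → Joint M d → Ω → ℝ}

theorem past_le (hX : ∀ t i a, Measurable (X t i a)) (t : ℕ) : past X t ≤ ‹MeasurableSpace Ω› :=
  iSup₂_le fun q _ => measurable_iff_comap_le.1 (measurable_pi_iff.2 fun a => hX q.1 q.2 a)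

/-- Independence is used only across rounds and players; the rewards of different arms for the same
player in the same round may be dependent. -/
theorem indep_past (hX : ∀ t i a, Measurable (X t i a))
    (hind : iIndepFun (fun (q : ℕ × Fin M) (ω : Ω) (a : Joint M d) => X q.1 q.2 a ω) P)
    (t : ℕ) (i : Fin M) (a : Joint M d) :
    Indep (past X t) (MeasurableSpace.comap (X t i a) inferInstance) P := by
  have h := indep_iSup_of_disjoint (fun q : ℕ × Fin M =>
    measurable_iff_comap_le.1 (measurable_pi_iff.2 fun a => hX q.1 q.2 a)) hind
    (S := {q | q.1 < t}) (T := {(t, i)}) (by simp)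
  refine indep_of_indep_of_le_right h ?_
  rw [iSup_singleton]
  have : X t i a = (fun f : Joint M d → ℝ => f a) ∘ fun ω a => X t i a ω := rfl
  rw [this, ← MeasurableSpace.comap_comp]
  exact MeasurableSpace.comap_mono (measurable_iff_comap_le.1 (measurable_pi_apply a))

theorem lintegral_exp_le_one [IsProbabilityMeasure P]
    (hν : ∀ a, HasSubgaussianMGF (fun x => x - mean ν a) 1 (ν a))
    (hX : ∀ t i a, Measurable (X t i a)) (hlaw : ∀ t i a, P.map (X t i a) = ν a)
    (t : ℕ) (i : Fin M) (a : Joint M d) (l : ℝ) :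
    ∫⁻ ω, ENNReal.ofReal (Real.exp (l * (X t i a ω - mean ν a) - l ^ 2 / 2)) ∂P ≤ 1 := by
  have hm : Measurable fun x : ℝ =>
      ENNReal.ofReal (Real.exp (l * (x - mean ν a) - l ^ 2 / 2)) := by fun_prop
  have h1 := (hν a).integrable_exp_mul l
  have h2 := (hν a).mgf_le l
  rw [← lintegral_map hm (hX t i a), hlaw]
  have h3 : ∀ x : ℝ, Real.exp (l * (x - mean ν a) - l ^ 2 / 2) =
      Real.exp (l * (x - mean ν a)) * Real.exp (-(l ^ 2 / 2)) := fun x => by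
    rw [← Real.exp_add, sub_eq_add_neg]
  simp only [h3]
  rw [← ofReal_integral_eq_lintegral_ofReal (h1.mul_const _)
    (Filter.Eventually.of_forall fun x => by positivity), integral_mul_const]
  refine ENNReal.ofReal_le_one.2 ?_
  calc (∫ x, Real.exp (l * (x - mean ν a)) ∂ν a) * Real.exp (-(l ^ 2 / 2))
      ≤ Real.exp ((1 : NNReal) * l ^ 2 / 2) * Real.exp (-(l ^ 2 / 2)) := by
        gcongr
        exact h2
    _ = 1 := by
        rw [← Real.exp_add]
        simp

/-- The exponential weights form a supermartingale. -/
theorem setLIntegral_expWeight_le [IsProbabilityMeasure P]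
    (hν : ∀ a, HasSubgaussianMGF (fun x => x - mean ν a) 1 (ν a))
    (hX : ∀ t i a, Measurable (X t i a)) (hlaw : ∀ t i a, P.map (X t i a) = ν a)
    (hind : iIndepFun (fun (q : ℕ × Fin M) (ω : Ω) (a : Joint M d) => X q.1 q.2 a ω) P)
    (j : Fin M) (a : Joint M d) (l : ℝ) (n s u : ℕ) (hsu : s ≤ u) {G : Set Ω}
    (hG : MeasurableSet[past X s] G) :
    Measurable[past X u]
      (fun ω => expWeight N L T dev (fun s j a => X s j a ω) j a (mean ν a) l n s u) ∧
    ∫⁻ ω in G, expWeight N L T dev (fun s j a => X s j a ω) j a (mean ν a) l n s u ∂P ≤ P G := by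
  classical
  induction u, hsu using Nat.le_induction with
  | base => simp [expWeight]
  | succ u hsu ih =>
    obtain ⟨hmeas, hle⟩ := ih
    let Y : Ω → ENNReal := fun ω =>
      expWeight N L T dev (fun s j a => X s j a ω) j a (mean ν a) l n s u
    let E : Ω → ENNReal := fun ω =>
      ENNReal.ofReal (Real.exp (l * (X u j a ω - mean ν a) - l ^ 2 / 2))
    let H : Set Ω := {ω | action N L T dev (fun s j a => X s j a ω) u = a ∧
      (run N L T dev (fun s j a => X s j a ω) u).1.count a < n}
    have hH : MeasurableSet[past X u] H :=
      (finMeas_run X u).2.1.preimage {q | q.2 = a ∧ q.1.count a < n}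
    have hsucc : ∀ ω, expWeight N L T dev (fun s j a => X s j a ω) j a (mean ν a) l n s (u + 1) =
        Y ω * if ω ∈ H then E ω else 1 := fun ω => by
      rw [expWeight, Finset.prod_Ico_succ_top hsu]
      rfl
    have hEm : Measurable[MeasurableSpace.comap (X u j a) inferInstance] E := by
      have hm : Measurable fun x : ℝ =>
        ENNReal.ofReal (Real.exp (l * (x - mean ν a) - l ^ 2 / 2)) := by fun_prop
      exact hm.comp (comap_measurable _)
    have hle' := past_mono X (Nat.le_succ u)
    simp only [hsucc]
    constructor
    · refine (hmeas.mono hle' le_rfl).mul (Measurable.ite (hle' _ hH) ?_ measurable_const)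
      have := measurable_past X (Nat.lt_succ_self u) j a
      have hm : Measurable fun x : ℝ =>
        ENNReal.ofReal (Real.exp (l * (x - mean ν a) - l ^ 2 / 2)) := by fun_prop
      exact hm.comp this
    · have hpu := past_le hX u
      have hGu := past_mono X hsu _ hG
      have hGH : MeasurableSet[past X u] (G ∩ H) := hGu.inter hH
      refine le_trans ?_ hle
      -- Whether round `u` contributes a factor is decided by the past. If it does, the factor is
      -- independent of the past with mean at most 1; otherwise it equals 1.
      rw [← lintegral_inter_add_sdiff _ G (hpu _ hH),
        ← lintegral_inter_add_sdiff (fun ω => expWeight N L T dev _ j a _ l n s u) G (hpu _ hH)]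
      refine add_le_add ?_ (le_of_eq ?_)
      · calc ∫⁻ ω in G ∩ H, Y ω * (if ω ∈ H then E ω else 1) ∂P
            = ∫⁻ ω in G ∩ H, Y ω * E ω ∂P :=
              setLIntegral_congr_fun (hpu _ hGH) fun ω hω => by
                simp only [if_pos hω.2]
          _ = ∫⁻ ω, (G ∩ H).indicator Y ω * E ω ∂P := by
              rw [← lintegral_indicator (hpu _ hGH)]
              congr 1
              ext ω
              by_cases h : ω ∈ G ∩ H <;> simp [h]
          _ = (∫⁻ ω, (G ∩ H).indicator Y ω ∂P) * ∫⁻ ω, E ω ∂P :=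
              lintegral_mul_eq_lintegral_mul_lintegral_of_independent_measurableSpace hpu
                (measurable_iff_comap_le.1 (hX u j a)) (indep_past hX hind u j a)
                (hmeas.indicator hGH) hEm
          _ ≤ (∫⁻ ω, (G ∩ H).indicator Y ω ∂P) * 1 := by
              gcongr
              exact lintegral_exp_le_one hν hX hlaw u j a l
          _ = ∫⁻ ω in G ∩ H, Y ω ∂P := by
              rw [mul_one, lintegral_indicator (hpu _ hGH)]
      · refine setLIntegral_congr_fun ((hpu _ hGu).diff (hpu _ hH)) fun ω hω => ?_
        simp only [if_neg hω.2, mul_one]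
        rfl

/-- A given confidence bound of the arm that is first pulled in round `s` rarely fails. -/
theorem measure_large_expWeight_le [IsProbabilityMeasure P]
    (hν : ∀ a, HasSubgaussianMGF (fun x => x - mean ν a) 1 (ν a))
    (hX : ∀ t i a, Measurable (X t i a)) (hlaw : ∀ t i a, P.map (X t i a) = ν a)
    (hind : iIndepFun (fun (q : ℕ × Fin M) (ω : Ω) (a : Joint M d) => X q.1 q.2 a ω) P)
    (hT : 2 ≤ T) (j : Fin M) (l : ℝ) (n s : ℕ) (hs : s < T) :
    P {ω | ∃ a, action N L T dev (fun s j a => X s j a ω) s = a ∧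
      (run N L T dev (fun s j a => X s j a ω) s).1.count a = 0 ∧
      (T : ENNReal) ^ 3 ≤
        expWeight N L T dev (fun s j a => X s j a ω) j a (mean ν a) l n s T} ≤
      ((T : ENNReal) ^ 3)⁻¹ := by
  classical
  have hA := finMeas_action (N := N) (L := L) (T := T) (dev := dev) X s
  let R := hA.1.toFinset
  let G : Joint M d → Set Ω := fun a => {ω | action N L T dev (fun s j a => X s j a ω) s = a}
  have hG : ∀ a, MeasurableSet[past X s] (G a) := fun a => hA.2 a
  have hT0 : (T : ENNReal) ^ 3 ≠ 0 := by
    have : (T : ENNReal) ≠ 0 := by exact_mod_cast (by omega : T ≠ 0)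
    positivity
  have hTt : (T : ENNReal) ^ 3 ≠ ⊤ := by finiteness
  -- Markov's inequality is localised to the event that `a` is played in round `s`. These events are
  -- disjoint, so summing over `a` costs no factor for the number of arms.
  have hbad : ∀ a, P (G a ∩ {ω | (T : ENNReal) ^ 3 ≤
      expWeight N L T dev (fun s j a => X s j a ω) j a (mean ν a) l n s T}) ≤
      P (G a) * ((T : ENNReal) ^ 3)⁻¹ := by
    intro a
    obtain ⟨hm, hle⟩ := setLIntegral_expWeight_le (N := N) (L := L) (T := T) (dev := dev) hν hX
      hlaw hind j a l n s T hs.le (hG a)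
    have hm' := hm.mono (past_le hX T) le_rfl
    have := mul_meas_ge_le_lintegral (μ := P.restrict (G a)) hm' ((T : ENNReal) ^ 3)
    rw [← div_eq_mul_inv, ENNReal.le_div_iff_mul_le (Or.inl hT0) (Or.inl hTt), mul_comm]
    refine le_trans (le_of_eq ?_) (this.trans hle)
    rw [Measure.restrict_apply (measurableSet_le measurable_const hm'), Set.inter_comm]
  calc _ ≤ P (⋃ a ∈ R, G a ∩ {ω | (T : ENNReal) ^ 3 ≤
      expWeight N L T dev (fun s j a => X s j a ω) j a (mean ν a) l n s T}) := by
        refine measure_mono ?_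
        rintro ω ⟨a, ha, -, h⟩
        exact Set.mem_biUnion ((Set.Finite.mem_toFinset _).2 ⟨ω, ha⟩) ⟨ha, h⟩
    _ ≤ ∑ a ∈ R, P (G a ∩ {ω | (T : ENNReal) ^ 3 ≤
      expWeight N L T dev (fun s j a => X s j a ω) j a (mean ν a) l n s T}) :=
        measure_biUnion_finset_le _ _
    _ ≤ ∑ a ∈ R, P (G a) * ((T : ENNReal) ^ 3)⁻¹ := Finset.sum_le_sum fun a _ => hbad a
    _ = P (⋃ a ∈ R, G a) * ((T : ENNReal) ^ 3)⁻¹ := by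
        rw [← Finset.sum_mul, measure_biUnion_finset]
        · intro a _ b _ hab
          refine Set.disjoint_left.2 fun ω ha hb => hab ?_
          exact (show _ = a from ha).symm.trans hb
        · exact fun a _ => past_le hX s _ (hG a)
    _ ≤ 1 * ((T : ENNReal) ^ 3)⁻¹ := by
        gcongr
        exact prob_le_one
    _ = _ := one_mul _

theorem exists_measure_not_clean_le [IsProbabilityMeasure P]
    (hν : ∀ a, HasSubgaussianMGF (fun x => x - mean ν a) 1 (ν a))
    (hX : ∀ t i a, Measurable (X t i a)) (hlaw : ∀ t i a, P.map (X t i a) = ν a)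
    (hind : iIndepFun (fun (q : ℕ × Fin M) (ω : Ω) (a : Joint M d) => X q.1 q.2 a ω) P)
    (hT : 2 ≤ T) :
    ∃ B : Set Ω, MeasurableSet B ∧ P.real B ≤ 2 * M / T ∧
      ∀ ω, ω ∉ B → Clean N L T dev (mean ν) fun s j a => X s j a ω := by
  classical
  let I : Finset (((ℕ × ℕ) × Fin M) × ℝ) :=
    ((Finset.range T ×ˢ Finset.range T) ×ˢ Finset.univ) ×ˢ {1, -1}
  let E : ((ℕ × ℕ) × Fin M) × ℝ → Set Ω := fun q =>
    {ω | ∃ a, action N L T dev (fun s j a => X s j a ω) q.1.1.1 = a ∧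
      (run N L T dev (fun s j a => X s j a ω) q.1.1.1).1.count a = 0 ∧
      (T : ENNReal) ^ 3 ≤ expWeight N L T dev (fun s j a => X s j a ω) q.1.2 a (mean ν a)
        (q.2 * eps T q.1.1.2) q.1.1.2 q.1.1.1 T}
  have hT0 : (0 : ℝ) < T := by positivity
  have hE : P (⋃ q ∈ I, E q) ≤ ENNReal.ofReal (2 * M / T) := by
    calc P (⋃ q ∈ I, E q) ≤ ∑ q ∈ I, P (E q) := measure_biUnion_finset_le _ _
      _ ≤ ∑ q ∈ I, ((T : ENNReal) ^ 3)⁻¹ := by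
          refine Finset.sum_le_sum fun q hq => ?_
          simp only [I, Finset.mem_product, Finset.mem_range] at hq
          exact measure_large_expWeight_le hν hX hlaw hind hT q.1.2 _ _ _ hq.1.1.1
      _ = (I.card : ENNReal) * ((T : ENNReal) ^ 3)⁻¹ := by simp
      _ ≤ ENNReal.ofReal (2 * M / T) := by
          -- The union runs over the first round, the number of pulls, the player and the sign; `2 M
          -- T²` events of probability at most `T⁻³` give `2M / T`.
          have hI : I.card = T * T * M * 2 := by
            simp only [I, Finset.card_product, Finset.card_range, Finset.card_univ,
              Fintype.card_fin]
            rw [Finset.card_pair (by norm_num)]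
          rw [hI, ← ENNReal.ofReal_natCast, ← ENNReal.ofReal_natCast, ← ENNReal.ofReal_pow hT0.le,
            ← ENNReal.ofReal_inv_of_pos (by positivity), ← ENNReal.ofReal_mul (by positivity)]
          refine ENNReal.ofReal_le_ofReal (le_of_eq ?_)
          push_cast
          field_simp
  -- A measurable hull replaces the union, so measurability of the bad events need not be shown.
  refine ⟨toMeasurable P (⋃ q ∈ I, E q), measurableSet_toMeasurable _ _, ?_, fun ω hω => ?_⟩
  · rw [measureReal_def, measure_toMeasurable]
    exact ENNReal.toReal_le_of_le_ofReal (by positivity) hE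
  · by_contra hcl
    obtain ⟨s, hs, n, hn, j, σ, hσ, a, h⟩ := exists_large_expWeight hT hcl
    refine hω (subset_toMeasurable _ _ (Set.mem_biUnion (x := (((s, n), j), σ)) ?_ ⟨a, h⟩))
    simp only [I, Finset.coe_product, Set.mem_prod, Finset.mem_coe, Finset.mem_range,
      Finset.mem_univ]
    exact ⟨⟨⟨hs, hn⟩, trivial⟩, hσ⟩

/-! ### The regret -/

theorem integrable_reward [IsProbabilityMeasure P]
    (hν : ∀ a, HasSubgaussianMGF (fun x => x - mean ν a) 1 (ν a))
    (hX : ∀ t i a, Measurable (X t i a)) (hlaw : ∀ t i a, P.map (X t i a) = ν a)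
    (t : ℕ) (i : Fin M) (a : Joint M d) : Integrable (X t i a) P := by
  have : IsProbabilityMeasure (ν a) :=
    hlaw t i a ▸ Measure.isProbabilityMeasure_map (hX t i a).aemeasurable
  have h : Integrable (fun x : ℝ => x) (ν a) := by
    refine ((hν a).integrable.add (integrable_const (mean ν a))).congr
      (Filter.Eventually.of_forall fun x => ?_)
    exact sub_add_cancel x _
  rw [← hlaw t i a] at h
  exact h.comp_measurable (hX t i a)

/-- The joint arm of round `t` is determined by the past, and the reward of each fixed arm in that
round is independent of it. Splitting by the finitely many possible arms replaces each reward by its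
mean. -/
theorem integral_reward_action [IsProbabilityMeasure P]
    (hν : ∀ a, HasSubgaussianMGF (fun x => x - mean ν a) 1 (ν a))
    (hX : ∀ t i a, Measurable (X t i a)) (hlaw : ∀ t i a, P.map (X t i a) = ν a)
    (hind : iIndepFun (fun (q : ℕ × Fin M) (ω : Ω) (a : Joint M d) => X q.1 q.2 a ω) P)
    (t : ℕ) (i : Fin M) :
    ∫ ω, X t i (action N L T dev (fun s j a => X s j a ω) t) ω ∂P =
      ∫ ω, mean ν (action N L T dev (fun s j a => X s j a ω) t) ∂P := by
  classical
  have hA := finMeas_action (N := N) (L := L) (T := T) (dev := dev) X t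
  let R := hA.1.toFinset
  let G : Joint M d → Set Ω := fun a => {ω | action N L T dev (fun s j a => X s j a ω) t = a}
  have hG : ∀ a, MeasurableSet[past X t] (G a) := fun a => hA.2 a
  have hG' : ∀ a, MeasurableSet (G a) := fun a => past_le hX t _ (hG a)
  have hdec : ∀ f : Joint M d → Ω → ℝ,
      (fun ω => f (action N L T dev (fun s j a => X s j a ω) t) ω) =
      fun ω => ∑ a ∈ R, (G a).indicator (f a) ω := by
    intro f
    ext ω
    rw [Finset.sum_eq_single (action N L T dev (fun s j a => X s j a ω) t)]
    · exact (Set.indicator_of_mem (s := G _) rfl _).symm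
    · intro b _ hb
      exact Set.indicator_of_notMem (fun h : ω ∈ G b => hb (show _ = b from h).symm) _
    · intro h
      exact absurd (hA.1.mem_toFinset.2 ⟨ω, rfl⟩) h
  have hint := integrable_reward hν hX hlaw t i
  rw [hdec fun a ω => X t i a ω, hdec fun a _ => mean ν a,
    integral_finsetSum _ fun a _ => (hint a).indicator (hG' a),
    integral_finsetSum _ fun a _ => (integrable_const _).indicator (hG' a)]
  refine Finset.sum_congr rfl fun a _ => ?_
  rw [integral_indicator (hG' a), integral_indicator (hG' a),
    ← setIntegral_condExp (past_le hX t) (hint a) (hG a)]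
  refine setIntegral_congr_ae (hG' a) ?_
  have hmean : ∫ ω, X t i a ω ∂P = mean ν a := by
    rw [mean, ← hlaw t i a]
    exact (integral_map (hX t i a).aemeasurable aestronglyMeasurable_id).symm
  have := condExp_indep_eq (measurable_iff_comap_le.1 (hX t i a)) (past_le hX t)
    (comap_measurable (X t i a)).stronglyMeasurable (indep_past hX hind t i a).symm
  filter_upwards [this] with ω hω _
  rw [hω, hmean]

theorem integrable_of_finMeas [IsProbabilityMeasure P] {f : Ω → ℝ}
    (hf : FinMeas ‹MeasurableSpace Ω› f) : Integrable f P := by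
  obtain ⟨C, hC⟩ := (hf.1.image fun y => ‖y‖).bddAbove
  exact Integrable.of_bound
    (show Measurable f from fun S _ => hf.preimage S).aestronglyMeasurable C
    (Filter.Eventually.of_forall fun ω => hC ⟨_, ⟨ω, rfl⟩, rfl⟩)

theorem regret_eq [IsProbabilityMeasure P]
    (hν : ∀ a, HasSubgaussianMGF (fun x => x - mean ν a) 1 (ν a))
    (hX : ∀ t i a, Measurable (X t i a)) (hlaw : ∀ t i a, P.map (X t i a) = ν a)
    (hind : iIndepFun (fun (q : ℕ × Fin M) (ω : Ω) (a : Joint M d) => X q.1 q.2 a ω) P)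
    (i : Fin M) :
    (∀ t, Integrable (fun ω =>
      gap (mean ν) (action N L T dev (fun s j a => X s j a ω) t)) P) ∧
    regret P N L T dev ν X i = ∫ ω, ∑ t ∈ Finset.range T,
      gap (mean ν) (action N L T dev (fun s j a => X s j a ω) t) ∂P := by
  have hA := fun t => (finMeas_action (N := N) (L := L) (T := T) (dev := dev) X t).mono
    (past_le hX t)
  have hint := fun t => integrable_of_finMeas (P := P) ((hA t).comp (mean ν))
  have hgap := fun t => integrable_of_finMeas (P := P) ((hA t).comp (gap (mean ν)))
  refine ⟨hgap, ?_⟩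
  rw [integral_finsetSum _ fun t _ => hgap t, regret]
  have : ∀ t, ∫ ω, gap (mean ν) (action N L T dev (fun s j a => X s j a ω) t) ∂P =
      (⨆ a, mean ν a) - ∫ ω, X t i (action N L T dev (fun s j a => X s j a ω) t) ω ∂P := by
    intro t
    rw [integral_reward_action hν hX hlaw hind t i]
    simp only [gap]
    rw [integral_sub (integrable_const _) (hint t)]
    simp
  simp only [this]
  rw [Finset.sum_sub_distrib]
  simp

theorem regret_le [IsProbabilityMeasure P] (hM : 1 ≤ M) (hN : ∀ v, N v = 0 → v = 0)
    (hL : 0 < L) (hT : 2 ≤ T) (hμ1 : ∀ a, 0 ≤ mean ν a ∧ mean ν a ≤ 1)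
    (hν : ∀ a, HasSubgaussianMGF (fun x => x - mean ν a) 1 (ν a))
    (hμ : ∀ a b, |mean ν a - mean ν b| ≤ L * armDist N a b)
    (hX : ∀ t i a, Measurable (X t i a)) (hlaw : ∀ t i a, P.map (X t i a) = ν a)
    (hind : iIndepFun (fun (q : ℕ × Fin M) (ω : Ω) (a : Joint M d) => X q.1 q.2 a ω) P)
    (hdev : ∀ i t c, OffGrid (dev i t c)) {z c : ℝ} (hz : 0 ≤ z)
    (h : ZoomingBound N L (mean ν) z c) (i : Fin M) :
    regret P N L T dev ν X i ≤ (2 + 2400 * 8 ^ (M * d) + 4 * M) *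
      ((T : ℝ) ^ ((z + 1) / (z + 2)) * (c * Real.log T) ^ (1 / (z + 2))) := by
  obtain ⟨hint, hreg⟩ := regret_eq (N := N) (L := L) (T := T) (dev := dev) hν hX hlaw hind i
  obtain ⟨B, hB, hPB, hclean⟩ := exists_measure_not_clean_le (N := N) (L := L) (T := T)
    (dev := dev) hν hX hlaw hind hT
  set W : ℝ := (T : ℝ) ^ ((z + 1) / (z + 2)) * (c * Real.log T) ^ (1 / (z + 2)) with hW
  have hW0 : 0 ≤ W := by
    have := h.nonneg
    have := log_nonneg_of_horizon T
    positivity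
  have hT0 : (0 : ℝ) < T := by positivity
  have hpt : ∀ ω, ∑ t ∈ Finset.range T,
      gap (mean ν) (action N L T dev (fun s j a => X s j a ω) t) ≤
      (2 + 2400 * 8 ^ (M * d)) * W + B.indicator (fun _ => T * (2 * W)) ω := by
    intro ω
    by_cases hω : ω ∈ B
    · rw [Set.indicator_of_mem hω]
      have : ∑ t ∈ Finset.range T,
          gap (mean ν) (action N L T dev (fun s j a => X s j a ω) t) ≤ T * (2 * W) := by
        refine (Finset.sum_le_sum fun t _ => h.gap_le hz hT hμ1 _).trans ?_
        rw [Finset.sum_const, Finset.card_range, nsmul_eq_mul]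
      have : 0 ≤ (2 + 2400 * 8 ^ (M * d)) * W := by positivity
      linarith
    · rw [Set.indicator_of_notMem hω, add_zero]
      exact sum_gap_le_of_clean hM hN hL hT hμ1 hμ hdev (hclean ω hω) hz h
  have hIB : Integrable (B.indicator fun _ : Ω => T * (2 * W)) P :=
    (integrable_const _).indicator hB
  rw [hreg]
  calc _ ≤ ∫ ω, ((2 + 2400 * 8 ^ (M * d)) * W + B.indicator (fun _ => T * (2 * W)) ω) ∂P :=
        integral_mono (integrable_finsetSum _ fun t _ => hint t)
          ((integrable_const _).add hIB) hpt
    _ = (2 + 2400 * 8 ^ (M * d)) * W + P.real B * (T * (2 * W)) := by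
        rw [integral_add (integrable_const _) hIB, integral_indicator hB]
        simp
    -- Failures occur with probability at most `2M / T` and cost at most `T * 2W`, which adds `4 M
    -- W`.
    _ ≤ (2 + 2400 * 8 ^ (M * d)) * W + 2 * M / T * (T * (2 * W)) := by gcongr
    _ = _ := by
        field_simp
        ring

end

end MZoomB

theorem mainTheorem5 (M d : ℕ) (hM : 1 ≤ M) (hd : 1 ≤ d) :
    ∃ C : ℝ, 0 < C ∧
      ∀ (N : Seminorm ℝ (Fin M → Fin d → ℝ)), (∀ v, N v = 0 → v = 0) →
      ∀ L : ℝ, 0 < L →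
        -- the dimension `M * d` is always admissible, with a common multiplier
        (∃ c : ℝ, ∀ μ : MZoomB.Joint M d → ℝ,
          (∀ a, 0 ≤ μ a ∧ μ a ≤ 1) → (∀ a b, |μ a - μ b| ≤ L * MZoomB.armDist N a b) →
          MZoomB.ZoomingBound N L μ ((M * d : ℕ) : ℝ) c) ∧
        -- the regret bound, in particular for `z = M * d`
        ∀ {Ω : Type*} [MeasurableSpace Ω] (P : Measure Ω) [IsProbabilityMeasure P]
          (ν : MZoomB.Joint M d → Measure ℝ) (X : ℕ → Fin M → MZoomB.Joint M d → Ω → ℝ)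
          (dev : Fin M → ℕ → MZoomB.Joint M d → MZoomB.Arm d),
          (∀ a, 0 ≤ MZoomB.mean ν a ∧ MZoomB.mean ν a ≤ 1) →
          (∀ a, HasSubgaussianMGF (fun x => x - MZoomB.mean ν a) 1 (ν a)) →
          (∀ a b, |MZoomB.mean ν a - MZoomB.mean ν b| ≤ L * MZoomB.armDist N a b) →
          (∀ t i a, Measurable (X t i a)) →
          (∀ t i a, P.map (X t i a) = ν a) →
          iIndepFun (fun (q : ℕ × Fin M) (ω : Ω) (a : MZoomB.Joint M d) => X q.1 q.2 a ω) P →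
          (∀ i t c, MZoomB.OffGrid (dev i t c)) →
          ∀ z c : ℝ, 0 ≤ z → MZoomB.ZoomingBound N L (MZoomB.mean ν) z c →
          ∀ T : ℕ, 2 ≤ T → ∀ i : Fin M,
            MZoomB.regret P N L T dev ν X i ≤
              C * (T : ℝ) ^ ((z + 1) / (z + 2)) * (c * Real.log T) ^ (1 / (z + 2)) := by
  refine ⟨2 + 2400 * 8 ^ (M * d) + 4 * M, by positivity, fun N hN L hL => ⟨?_, ?_⟩⟩
  · obtain ⟨c, hc⟩ := MZoomB.exists_zoomingBound (M := M) (d := d) N hL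
    exact ⟨c, fun μ h1 _ => hc μ h1⟩
  · intro Ω _ P _ ν X dev hμ1 hν hμ hX hlaw hind hdev z c hz h T hT i
    rw [mul_assoc]
    exact MZoomB.regret_le hM hN hL hT hμ1 hν hμ hX hlaw hind hdev hz h i
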